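/- **Proposition 3.4.** *Setting.* Let $(X,Y)$ take values in $\mathcal X\times\mathbb R$, let $\mu$ be the law of $X$, and write $\|f\|_{L_p}=(\mathbb E|f(X)|^p)^{1/p}$, $\|f-Y\|_{L_p}=(\mathbb E|f(X)-Y|^p)^{1/p}$. Let $Y\in L_2$ and let $\mathcal F\subset L_2(\mu)$ be a locally compact class of measurable real functions on $\mathcal X$ which is pointwise measurable (it has a countable subset such that each $f\in\mathcal F$ is the pointwise limit of a sequence from that subset). Let $f^*\in\mathcal F$ minimize $\mathbb E(f(X)-Y)^2$ over $f\in\mathcal F$, and let $\sigma>0$. Assume one of the following. (A) $L\ge 1$, $\mathcal F$ is convex, $\|f-h\|_{L_4}\le L\|f-h\|_{L_2}$ and $\|f-Y\|_{L_4}\le L\|f-Y\|_{L_2}$ for all $f,h\in\mathcal F$, and $\|f^*-Y\|_{L_2}\le\sigma$. (Put $q=4$.) (B) $q>2$, $L>1$, $\|f\|_{L_q}\le L\|f\|_{L_2}$ for all $f\in\mathrm{span}(\mathcal F)$, and $Y=f_0(X)+W$ with $f_0\in\mathcal F$ and $W$ independent of $X$, $\mathbb EW=0$, $\|W\|_{L_2}\le\sigma$.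 *Complexity parameters.* For $h\in\mathcal F$ and $\rho>0$ let $\mathcal F_{h,\rho}=\{\lambda(f-h): f\in\mathcal F,\ 0\le\lambda\le1,\ \|\lambda(f-h)\|_{L_2}\le\rho\}$, and let $\mathcal M(\mathcal F_{h,\rho},\varepsilon)$ be the largest cardinality of a subset whose distinct points are at $L_2$-distance at least $\varepsilon$. Let $(X_i,Y_i)$ be independent copies of $(X,Y)$ and $\varepsilon_i$ independent uniform random signs, independent of the copies. Put, with infima over $\rho>0$ and $\inf\emptyset=\infty$, $$\lambda_{\mathcal Q}(\kappa,\eta,h)=\inf\{\rho:\log\mathcal M(\mathcal F_{h,\rho},\eta\rho)\le\kappa^2N\},\qquad \lambda_{\mathcal M}(\kappa,\eta,h)=\inf\{\rho:\log\mathcal M(\mathcal F_{h,\rho},\eta\rho)\le\kappa^2N\rho^2\},$$ $$r_E(\kappa,h)=\inf\Big\{\rho:\mathbb E\sup_{u\in\mathcal F_{h,\rho}}\Big|\tfrac1{\sqrt N}\sum_{i=1}^N\varepsilon_iu(X_i)\Big|\le\kappa\sqrt N\rho\Big\},$$ $$\bar r_{\mathcal M}(\kappa,h)=\inf\Big\{\rho:\mathbb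 E\sup_{u\in\mathcal F_{h,\rho}}\Big|\tfrac1{\sqrt N}\sum_{i=1}^N\varepsilon_iu(X_i)(h(X_i)-Y_i)\Big|\le\kappa\sqrt N\rho^2\Big\},$$ and $r^*(f^*)=\max\{\lambda_{\mathcal Q}(c_1,c_2,f^*),\lambda_{\mathcal M}(c_1/\sigma,c_2,f^*),r_E(c_1,f^*),\bar r_{\mathcal M}(c_1,f^*)\}$. *Preliminary round.* Fix $r>0$, constants $\alpha,\beta,\theta>0$ and an integer $\ell\ge1$. Let $(X_i,Y_i)_{i=1}^{2N}$ be independent copies of $(X,Y)$. For $f,h\in\mathcal F$ let $\Phi(f,h)$ be the smallest median of the means of $|f(X_i)-h(X_i)|$ over $\lfloor N/\ell\rfloor$ consecutive blocks of length $\ell$ in $\{1,\dots,N\}$; put $\mathcal{DO}(f,h)=1$ if $\Phi(f,h)\ge\beta r$ and $\mathcal{DO}(f,h)=0$ otherwise (also if $N<\ell$). Let $n=\lfloor\theta N\min\{1,(r/\sigma)^2\}\rfloor$, and let $I_1,\dots,I_n$ be consecutive disjoint blocks of length $\lfloor N/n\rfloor$ in $\{N+1,\dots,2N\}$, starting at $N+1$.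 The function $f$ *defeats* $h$ if $\mathcal{DO}(f,h)=1$ and $$\frac1{|I_j|}\sum_{i\in I_j}\big((f(X_i)-Y_i)^2-(h(X_i)-Y_i)^2\big)<0$$ for more than $n/2$ of the indices $j$. A function in $\mathcal F$ *qualifies* if no $h\in\mathcal F$ defeats it; $H$ is the set of qualifiers. *Claim.* There are constants $c_0,c_1,c_2,\theta,\alpha,\beta>0$ with $c_2<1$, $\theta<1/4$, $\alpha<1<\beta$, and an integer $\ell\ge1$, depending only on $L$ in case (A) and only on $q$ and $L$ in case (B), such that for all $N$, $(X,Y)$, $\mathcal F$, $f^*$, $\sigma$ as above and every $r>0$ with $r\ge2r^*(f^*)$ the following hold simultaneously with probability at least $$1-2\exp\big(-c_0N\min\{1,r^2/\sigma^2\}\big)$$ (that is, on a measurable set of samples of at least this probability): 1. for every $h\in\mathcal F$ with $\mathcal{DO}(f^*,h)=1$, $f^*$ defeats $h$; 2. $f^*\in H$; 3. every $h\in H$ satisfies $\mathcal{DO}(f^*,h)=0$ and $\|h-f^*\|_{L_2}\le(\beta/\alpha)r$. -/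

import Mathlib

open MeasureTheory ProbabilityTheory
open scoped ENNReal

universe u

noncomputable section

namespace MoMTournament

variable {𝓧 : Type u}

/-! Throughout, `P` is the joint law of `(X, Y)` on `𝓧 × ℝ`, the law of `X` is
`P.map Prod.fst`, and a class of functions is a set `F` of functions `𝓧 → ℝ`. -/

/-- The star-shaped hull of `A` around `0`: all `t • a` with `a ∈ A` and `0 ≤ t ≤ 1`. -/
def starZero (A : Set (𝓧 → ℝ)) : Set (𝓧 → ℝ) :=
  {u | ∃ a ∈ A, ∃ t : ℝ, 0 ≤ t ∧ t ≤ 1 ∧ u = t • a}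

/-- The localization `F_{h,r} = star(F - h, 0) ∩ rD`, where `D` is the unit ball of `L₂(μ)`. -/
def localization [MeasurableSpace 𝓧] (μ : Measure 𝓧) (F : Set (𝓧 → ℝ)) (h : 𝓧 → ℝ) (r : ℝ) :
    Set (𝓧 → ℝ) :=
  {u | u ∈ starZero ((fun f => f - h) '' F) ∧ eLpNorm u 2 μ ≤ ENNReal.ofReal r}

/-- The packing number `M(H, εD)`: the largest cardinality (possibly `⊤`) of a subset of `H`
whose distinct points are at `L₂(μ)` distance at least `ε`. -/
def packingNumber [MeasurableSpace 𝓧] (μ : Measure 𝓧) (H : Set (𝓧 → ℝ)) (ε : ℝ) : ℕ∞ :=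
  ⨆ (T : Finset (𝓧 → ℝ)) (_ : (T : Set (𝓧 → ℝ)) ⊆ H)
    (_ : ∀ f ∈ T, ∀ g ∈ T, f ≠ g → ENNReal.ofReal ε ≤ eLpNorm (f - g) 2 μ), (T.card : ℕ∞)

/-- `log M(F_{h,r}, η r D)`, with value `⊤` when the packing number is infinite. -/
def logPacking [MeasurableSpace 𝓧] (μ : Measure 𝓧) (F : Set (𝓧 → ℝ)) (h : 𝓧 → ℝ) (η r : ℝ) :
    EReal :=
  ENNReal.log ((packingNumber μ (localization μ F h r) (η * r) : ℕ∞) : ℝ≥0∞)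

/-- `λ_Q(κ, η, h)`; the infimum of the empty set is `⊤`. -/
def lambdaQ [MeasurableSpace 𝓧] (μ : Measure 𝓧) (N : ℕ) (F : Set (𝓧 → ℝ)) (h : 𝓧 → ℝ)
    (κ η : ℝ) : ℝ≥0∞ :=
  ⨅ (r : ℝ) (_ : 0 < r) (_ : logPacking μ F h η r ≤ ((κ ^ 2 * N : ℝ) : EReal)), ENNReal.ofReal r

/-- `λ_M(κ, η, h)`; the infimum of the empty set is `⊤`. -/
def lambdaM [MeasurableSpace 𝓧] (μ : Measure 𝓧) (N : ℕ) (F : Set (𝓧 → ℝ)) (h : 𝓧 → ℝ)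
    (κ η : ℝ) : ℝ≥0∞ :=
  ⨅ (r : ℝ) (_ : 0 < r) (_ : logPacking μ F h η r ≤ ((κ ^ 2 * N * r ^ 2 : ℝ) : EReal)),
    ENNReal.ofReal r

/-- `E sup_{u ∈ A} |N^{-1/2} ∑ᵢ εᵢ ξ(Xᵢ, Yᵢ) u(Xᵢ)|`, where `(Xᵢ, Yᵢ)` are independent with law `P`
and `εᵢ` are independent uniform signs, independent of the sample. The expectation over the signs
is written as the average over all `2 ^ N` sign vectors. -/
def rademacherSup [MeasurableSpace 𝓧] (P : Measure (𝓧 × ℝ)) (N : ℕ) (A : Set (𝓧 → ℝ))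
    (ξ : 𝓧 × ℝ → ℝ) : ℝ≥0∞ :=
  (2 ^ N)⁻¹ * ∑ ε ∈ Fintype.piFinset (fun _ : Fin N => ({-1, 1} : Finset ℝ)),
    ∫⁻ D, ⨆ v ∈ A, ENNReal.ofReal |(√(N : ℝ))⁻¹ * ∑ i, ε i * (ξ (D i) * v (D i).1)|
      ∂(Measure.pi fun _ : Fin N => P)

/-- `r_E(κ, h)`; the infimum of the empty set is `⊤`. -/
def rE [MeasurableSpace 𝓧] (P : Measure (𝓧 × ℝ)) (N : ℕ) (F : Set (𝓧 → ℝ)) (h : 𝓧 → ℝ)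
    (κ : ℝ) : ℝ≥0∞ :=
  ⨅ (r : ℝ) (_ : 0 < r)
    (_ : rademacherSup P N (localization (P.map Prod.fst) F h r) (fun _ => 1)
      ≤ ENNReal.ofReal (κ * √(N : ℝ) * r)), ENNReal.ofReal r

/-- The multiplier fixed point `r̄_M(κ, h)`; the infimum of the empty set is `⊤`. -/
def rM [MeasurableSpace 𝓧] (P : Measure (𝓧 × ℝ)) (N : ℕ) (F : Set (𝓧 → ℝ)) (h : 𝓧 → ℝ)
    (κ : ℝ) : ℝ≥0∞ :=
  ⨅ (r : ℝ) (_ : 0 < r)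
    (_ : rademacherSup P N (localization (P.map Prod.fst) F h r) (fun z => h z.1 - z.2)
      ≤ ENNReal.ofReal (κ * √(N : ℝ) * r ^ 2)), ENNReal.ofReal r

/-- `r*(h) = max {λ_Q(c₁, c₂, h), λ_M(c₁/σ, c₂, h), r_E(c₁, h), r̄_M(c₁, h)}`. -/
def rStar [MeasurableSpace 𝓧] (P : Measure (𝓧 × ℝ)) (N : ℕ) (F : Set (𝓧 → ℝ)) (h : 𝓧 → ℝ)
    (σ c₁ c₂ : ℝ) : ℝ≥0∞ :=
  max (max (lambdaQ (P.map Prod.fst) N F h c₁ c₂) (lambdaM (P.map Prod.fst) N F h (c₁ / σ) c₂))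
    (max (rE P N F h c₁) (rM P N F h c₁))

/-- The class is locally compact as a subset of `L₂(μ)`. -/
def IsLocallyCompactClass [MeasurableSpace 𝓧] (μ : Measure 𝓧) (F : Set (𝓧 → ℝ)) : Prop :=
  LocallyCompactSpace {g : Lp ℝ 2 μ | ∃ f ∈ F, (g : 𝓧 → ℝ) =ᵐ[μ] f}

/-- The usual measurability condition for suprema over `F`: some countable subset `G` of `F` is
such that every member of `F` is the pointwise limit of a sequence from `G`. -/
def IsPointwiseMeasurableClass (F : Set (𝓧 → ℝ)) : Prop :=
  ∃ G ⊆ F, G.Countable ∧ ∀ f ∈ F, ∃ g : ℕ → 𝓧 → ℝ, (∀ k, g k ∈ G) ∧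
    ∀ x, Filter.Tendsto (fun k => g k x) Filter.atTop (nhds (f x))

/-- `fs` minimizes the risk `E (f(X) - Y)²` over `F`. -/
def IsRiskMinimizer [MeasurableSpace 𝓧] (P : Measure (𝓧 × ℝ)) (F : Set (𝓧 → ℝ))
    (fs : 𝓧 → ℝ) : Prop :=
  fs ∈ F ∧ ∀ f ∈ F, ∫ z, (fs z.1 - z.2) ^ 2 ∂P ≤ ∫ z, (f z.1 - z.2) ^ 2 ∂P

/-- The standing assumptions: `F ⊆ L₂(μ)` is a locally compact class of measurable functions
(with the measurability condition above), `Y ∈ L₂`, and `fs` is a risk minimizer in `F`. -/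
structure LearningProblem [MeasurableSpace 𝓧] (P : Measure (𝓧 × ℝ)) (F : Set (𝓧 → ℝ))
    (fs : 𝓧 → ℝ) : Prop where
  measurable : ∀ f ∈ F, Measurable f
  pointwiseMeasurable : IsPointwiseMeasurableClass F
  memLp : ∀ f ∈ F, MemLp f 2 (P.map Prod.fst)
  memLp_target : MemLp (fun z : 𝓧 × ℝ => z.2) 2 P
  locallyCompact : IsLocallyCompactClass (P.map Prod.fst) F
  minimizer : IsRiskMinimizer P F fs

/-- Convex class, `L₄`-`L₂` norm equivalence for differences `f - h` and for `f(X) - Y`,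
and `‖fs(X) - Y‖_{L₂} ≤ σ`. -/
structure ConvexSetting [MeasurableSpace 𝓧] (L σ : ℝ) (P : Measure (𝓧 × ℝ)) (F : Set (𝓧 → ℝ))
    (fs : 𝓧 → ℝ) : Prop extends LearningProblem P F fs where
  convex : Convex ℝ F
  norm_sub : ∀ f ∈ F, ∀ h ∈ F, eLpNorm (f - h) 4 (P.map Prod.fst)
    ≤ ENNReal.ofReal L * eLpNorm (f - h) 2 (P.map Prod.fst)
  norm_noise : ∀ f ∈ F, eLpNorm (fun z : 𝓧 × ℝ => f z.1 - z.2) 4 P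
    ≤ ENNReal.ofReal L * eLpNorm (fun z : 𝓧 × ℝ => f z.1 - z.2) 2 P
  noise_le : eLpNorm (fun z : 𝓧 × ℝ => fs z.1 - z.2) 2 P ≤ ENNReal.ofReal σ

/-- `L_q`-`L₂` norm equivalence on the linear span of `F`, and `Y = f₀(X) + W` with `f₀ ∈ F`, where
the noise `W = Y - f₀(X)` is independent of `X`, has mean zero and `‖W‖_{L₂} ≤ σ`. -/
structure IndependentNoiseSetting [MeasurableSpace 𝓧] (q L σ : ℝ) (P : Measure (𝓧 × ℝ))
    (F : Set (𝓧 → ℝ)) (fs : 𝓧 → ℝ) : Prop extends LearningProblem P F fs where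
  norm_span : ∀ f ∈ Submodule.span ℝ F, eLpNorm f (ENNReal.ofReal q) (P.map Prod.fst)
    ≤ ENNReal.ofReal L * eLpNorm f 2 (P.map Prod.fst)
  noise : ∃ f₀ ∈ F, IndepFun (fun z : 𝓧 × ℝ => z.2 - f₀ z.1) Prod.fst P ∧
    ∫ z, (z.2 - f₀ z.1) ∂P = 0 ∧
    eLpNorm (fun z : 𝓧 × ℝ => z.2 - f₀ z.1) 2 P ≤ ENNReal.ofReal σ

/-- The mean of `v` over the `j`-th (`j = 0, 1, …`) consecutive block of `m` coordinates. -/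
def blockMean {N : ℕ} (m : ℕ) (v : Fin N → ℝ) (j : ℕ) : ℝ :=
  (m : ℝ)⁻¹ *
    ∑ i ∈ Finset.univ.filter (fun i : Fin N => j * m ≤ i.val ∧ i.val < (j + 1) * m), v i

/-- The smallest median of `z₁, …, z_k`: the least `t` such that at least half of the values are
at most `t` and at least half of the values are at least `t`. -/
def smallestMedian {k : ℕ} (z : Fin k → ℝ) : ℝ :=
  sInf {t : ℝ | k ≤ 2 * (Finset.univ.filter fun j => z j ≤ t).card ∧
    k ≤ 2 * (Finset.univ.filter fun j => t ≤ z j).card}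

/-- `Med_ℓ(v)`: the median of the means of `v` over `⌊N / ℓ⌋` consecutive blocks of length `ℓ`
(when `ℓ` divides `N` these partition all the coordinates). -/
def medianOfMeans {N : ℕ} (ℓ : ℕ) (v : Fin N → ℝ) : ℝ :=
  smallestMedian fun j : Fin (N / ℓ) => blockMean ℓ v j

/-- `Φ(f, h) = Med_ℓ (|f(Xᵢ) - h(Xᵢ)|)ᵢ`, computed on the first sample. -/
def distFunctional {N : ℕ} (ℓ : ℕ) (D : Fin N → 𝓧 × ℝ) (f h : 𝓧 → ℝ) : ℝ :=
  medianOfMeans ℓ fun i => |f (D i).1 - h (D i).1|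

/-- The distance oracle says `DO(f, h) = 1`: the match between `f` and `h` takes place. -/
def MatchAllowed {N : ℕ} (ℓ : ℕ) (β r : ℝ) (D : Fin N → 𝓧 × ℝ) (f h : 𝓧 → ℝ) : Prop :=
  β * r ≤ distFunctional ℓ D f h

/-- The number of blocks, the integer part of `θ N min {1, (r/σ)²}`. -/
def numBlocks (θ σ r : ℝ) (N : ℕ) : ℕ :=
  ⌊θ * N * min 1 ((r / σ) ^ 2)⌋₊

/-- `B_{f,h}(j)`: the mean of `(f(Xᵢ) - Yᵢ)² - (h(Xᵢ) - Yᵢ)²` over the `j`-th block of length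
`m = ⌊N / n⌋` of the second sample. -/
def blockLossDiff {N : ℕ} (n : ℕ) (D : Fin N → 𝓧 × ℝ) (f h : 𝓧 → ℝ) (j : ℕ) : ℝ :=
  blockMean (N / n) (fun i => (f (D i).1 - (D i).2) ^ 2 - (h (D i).1 - (D i).2) ^ 2) j

/-- `f` defeats `h`: their match takes place, and `f` has the smaller empirical loss on more than
half of the `n` blocks of the second sample. -/
def Defeats {N : ℕ} (ℓ n : ℕ) (β r : ℝ) (D₁ D₂ : Fin N → 𝓧 × ℝ) (f h : 𝓧 → ℝ) : Prop :=
  MatchAllowed ℓ β r D₁ f h ∧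
    n < 2 * (Finset.univ.filter fun j : Fin n => blockLossDiff n D₂ f h j < 0).card

/-- The set `H` of qualifiers: members of `F` that lose no match against a member of `F`. -/
def qualifiers {N : ℕ} (ℓ n : ℕ) (β r : ℝ) (F : Set (𝓧 → ℝ)) (D₁ D₂ : Fin N → 𝓧 × ℝ) :
    Set (𝓧 → ℝ) :=
  {f | f ∈ F ∧ ∀ h ∈ F, ¬ Defeats ℓ n β r D₁ D₂ h f}

/-- The event, in the samples `(Xᵢ, Yᵢ)_{i ≤ N}` and `(Xᵢ, Yᵢ)_{N < i ≤ 2N}`, on which `fs` defeats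
every `h ∈ F` that it meets, `fs` qualifies, and every qualifier `h` has `DO(fs, h) = 0` and is
within `(β/α) r` of `fs`. -/
def preliminaryRoundEvent [MeasurableSpace 𝓧] (P : Measure (𝓧 × ℝ)) (F : Set (𝓧 → ℝ))
    (fs : 𝓧 → ℝ) (N ℓ n : ℕ) (α β r : ℝ) : Set ((Fin N → 𝓧 × ℝ) × (Fin N → 𝓧 × ℝ)) :=
  {D | (∀ h ∈ F, MatchAllowed ℓ β r D.1 fs h → Defeats ℓ n β r D.1 D.2 fs h) ∧
    fs ∈ qualifiers ℓ n β r F D.1 D.2 ∧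
    ∀ h ∈ qualifiers ℓ n β r F D.1 D.2, ¬ MatchAllowed ℓ β r D.1 fs h ∧
      eLpNorm (h - fs) 2 (P.map Prod.fst) ≤ ENNReal.ofReal (β / α * r)}

/-- `E` has (inner) probability at least `p`: it contains a measurable set of probability at
least `p`. -/
def HoldsWithProb {Ω : Type u} [MeasurableSpace Ω] (Q : Measure Ω) (p : ℝ) (E : Set Ω) : Prop :=
  ∃ A ⊆ E, MeasurableSet A ∧ ENNReal.ofReal p ≤ Q A

/-- The law of the two independent samples of `N` independent pairs each. -/
def sampleLaw [MeasurableSpace 𝓧] (P : Measure (𝓧 × ℝ)) (N : ℕ) :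
    Measure ((Fin N → 𝓧 × ℝ) × (Fin N → 𝓧 × ℝ)) :=
  (Measure.pi fun _ : Fin N => P).prod (Measure.pi fun _ : Fin N => P)

end MoMTournament

end

/-! Scaling `f - f*` down to norm at most `r` turns every comparison of `f` with `f*` into one about
the star-shaped class `F_{f*,r}`. Symmetrization and contraction bound the expected number of blocks
on which the mean of `|u|`, or of `u` times the noise, is far from its expectation for some `u` in
this class, and bounded differences concentrate that number: outside an event of exponentially small
probability it is less than a tenth of the blocks, simultaneously for all `u`.

A tenth of the blocks does not move a median far, and `‖u‖_{L₁} ≥ a ‖u‖_{L₂}` by interpolation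
from the norm equivalence, so the distance oracle finds `‖f - f*‖_{L₂}` up to a constant factor
as soon as one of the two exceeds `r`. Such an `f` loses to `f*`: in the excess loss the
quadratic part `(f - f*)²` is scaled by `λ²` and the multiplier part `2 (f* - Y) (f - f*)` by
`λ ≤ 1` only, so it is enough to compare them at norm `r`, where on most blocks the first is of
order `a² r²` and the second, whose expectation is nonnegative, at least a small negative
multiple of `a² r²`. -/

namespace MoMTournament

open scoped BigOperators

section Signs

variable {J K : Type*}

lemma abs_iSup_le_sum_abs [Fintype K] [Nonempty K] (f : K → ℝ) : |⨆ k, f k| ≤ ∑ k, |f k| := by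
  obtain ⟨k, hk⟩ := exists_eq_ciSup_of_finite (f := f)
  rw [← hk]
  exact Finset.single_le_sum (f := fun k => |f k|) (fun _ _ => abs_nonneg _) (Finset.mem_univ k)

lemma iSup_add_abs_add_iSup_sub_abs_le [Finite K] [Nonempty K] (A t : K → ℝ) :
    (⨆ k, (A k + |t k|)) + ⨆ k, (A k - |t k|) ≤ (⨆ k, (A k + t k)) + ⨆ k, (A k - t k) := by
  obtain ⟨k, hk⟩ := exists_eq_ciSup_of_finite (f := fun k => A k + |t k|)
  obtain ⟨l, hl⟩ := exists_eq_ciSup_of_finite (f := fun k => A k - |t k|)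
  rw [← hk, ← hl]
  have hk_add := Finite.le_ciSup (fun k => A k + t k) k
  have hk_sub := Finite.le_ciSup (fun k => A k - t k) k
  have hl_add := Finite.le_ciSup (fun k => A k + t k) l
  have hl_sub := Finite.le_ciSup (fun k => A k - t k) l
  have habs := abs_sub_abs_le_abs_sub (t k) (t l)
  rcases abs_cases (t k - t l) with ⟨h, -⟩ | ⟨h, -⟩ <;> linarith

lemma expect_mul_left {G : Type*} [Group G] [Fintype G] (a : G) (f : G → ℝ) :
    𝔼 x, f (a * x) = 𝔼 x, f x :=
  Fintype.expect_equiv (Equiv.mulLeft a) _ _ fun _ => rfl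

lemma expect_comp_of_surjective {G G' : Type*} [Group G] [Fintype G] [Group G'] [Fintype G']
    {φ : G' →* G} (hφ : Function.Surjective φ) (f : G → ℝ) : 𝔼 x, f (φ x) = 𝔼 y, f y := by
  have htranslate (y : G) : 𝔼 x, f (y * φ x) = 𝔼 x, f (φ x) := by
    obtain ⟨x₀, rfl⟩ := hφ y
    simpa only [Function.comp_apply, map_mul] using expect_mul_left x₀ (f ∘ φ)
  calc 𝔼 x, f (φ x) = 𝔼 y, 𝔼 x, f (y * φ x) := by
        simp_rw [htranslate, Fintype.expect_const]
    _ = 𝔼 x, 𝔼 y, f (y * φ x) := Finset.expect_comm _ _ _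
    _ = 𝔼 _x : G', 𝔼 y, f y := Finset.expect_congr rfl fun x _ =>
        Fintype.expect_equiv (Equiv.mulRight (φ x)) _ _ fun _ => rfl
    _ = 𝔼 y, f y := Fintype.expect_const _

variable [Fintype J] [DecidableEq J]

lemma expect_comp_injective {J' : Type*} [Fintype J'] [DecidableEq J'] {e : J → J'}
    (he : Function.Injective e) (f : (J → ℤˣ) → ℝ) :
    𝔼 ε : J' → ℤˣ, f (ε ∘ e) = 𝔼 ε, f ε :=
  expect_comp_of_surjective
    (φ := MonoidHom.pi fun j => Pi.evalMonoidHom (fun _ : J' => ℤˣ) (e j))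
    he.surjective_comp_right f

lemma two_mul_expect_iSup_sum_sign_mul (x : K → J → ℝ) (i : J) :
    2 * 𝔼 ε : J → ℤˣ, ⨆ k, ∑ j, (ε j : ℝ) * x k j =
      𝔼 ε : J → ℤˣ, ((⨆ k, ((∑ j ∈ Finset.univ.erase i, (ε j : ℝ) * x k j) + x k i)) +
        ⨆ k, ((∑ j ∈ Finset.univ.erase i, (ε j : ℝ) * x k j) - x k i)) := by
  set τ : J → ℤˣ := Function.update 1 i (-1) with hτ
  have hsplit (ε : J → ℤˣ) (k : K) : ∑ j, (ε j : ℝ) * x k j =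
      (∑ j ∈ Finset.univ.erase i, (ε j : ℝ) * x k j) + ε i * x k i :=
    (Finset.sum_erase_add _ _ (Finset.mem_univ i)).symm
  have hflip (ε : J → ℤˣ) (k : K) : ∑ j, ((τ * ε) j : ℝ) * x k j =
      (∑ j ∈ Finset.univ.erase i, (ε j : ℝ) * x k j) - ε i * x k i := by
    rw [hsplit, sub_eq_add_neg]
    congr 1
    · refine Finset.sum_congr rfl fun j hj => ?_
      simp [hτ, Function.update_of_ne (Finset.ne_of_mem_erase hj)]
    · simp [hτ]
  rw [two_mul]
  nth_rw 2 [← expect_mul_left τ]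
  rw [← Finset.expect_add_distrib]
  refine Finset.expect_congr rfl fun ε _ => ?_
  simp only [hsplit ε, hflip ε]
  rcases Int.units_eq_one_or (ε i) with h | h
  · simp [h]
  · simp [h, add_comm, sub_eq_add_neg]

lemma expect_iSup_sum_sign_mul_le_of_eq_abs [Finite K] [Nonempty K] {x y : K → J → ℝ} (i : J)
    (hi : ∀ k, y k i = |x k i|) (hne : ∀ k, ∀ j ≠ i, y k j = x k j) :
    𝔼 ε : J → ℤˣ, ⨆ k, ∑ j, (ε j : ℝ) * y k j ≤ 𝔼 ε : J → ℤˣ, ⨆ k, ∑ j, (ε j : ℝ) * x k j := by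
  have hrest (ε : J → ℤˣ) (k : K) : ∑ j ∈ Finset.univ.erase i, (ε j : ℝ) * y k j =
      ∑ j ∈ Finset.univ.erase i, (ε j : ℝ) * x k j :=
    Finset.sum_congr rfl fun j hj => by rw [hne k j (Finset.ne_of_mem_erase hj)]
  refine le_of_mul_le_mul_left ?_ (zero_lt_two' ℝ)
  simp only [two_mul_expect_iSup_sum_sign_mul _ i, hrest, hi]
  exact Finset.expect_le_expect fun ε _ => iSup_add_abs_add_iSup_sub_abs_le _ _

theorem expect_iSup_sum_sign_mul_abs_le [Finite K] [Nonempty K] (x : K → J → ℝ) :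
    𝔼 ε : J → ℤˣ, ⨆ k, ∑ j, (ε j : ℝ) * |x k j| ≤ 𝔼 ε : J → ℤˣ, ⨆ k, ∑ j, (ε j : ℝ) * x k j := by
  suffices h : ∀ S : Finset J,
      𝔼 ε : J → ℤˣ, ⨆ k, ∑ j, (ε j : ℝ) * (if j ∈ S then |x k j| else x k j) ≤
        𝔼 ε : J → ℤˣ, ⨆ k, ∑ j, (ε j : ℝ) * x k j by simpa using h Finset.univ
  intro S
  induction S using Finset.induction_on with
  | empty => simp
  | insert i S hi ih =>
    refine le_trans (expect_iSup_sum_sign_mul_le_of_eq_abs i ?_ ?_) ih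
    · simp [hi]
    · intro k j hj
      simp [hj]

lemma expect_iSup_sum_sign_mul_le_of_injective [Finite K] [Nonempty K] {J' : Type*} [Fintype J']
    [DecidableEq J'] {e : J → J'} (he : Function.Injective e) (x : K → J' → ℝ) :
    𝔼 ε : J → ℤˣ, ⨆ k, ∑ j, (ε j : ℝ) * x k (e j) ≤
      𝔼 ε : J' → ℤˣ, ⨆ k, |∑ j, (ε j : ℝ) * x k j| := by
  classical
  let τ : J' → ℤˣ := fun j => if j ∈ Set.range e then 1 else -1
  -- Flipping the signs off the range of `e` and averaging leaves the sum over that range.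
  have hflip (ε : J' → ℤˣ) (k : K) : 2 * ∑ j, ((ε ∘ e) j : ℝ) * x k (e j) =
      (∑ j, (ε j : ℝ) * x k j) + ∑ j, ((τ * ε) j : ℝ) * x k j := by
    have hrange : ∑ j, ((ε ∘ e) j : ℝ) * x k (e j) =
        ∑ j ∈ Finset.univ.map ⟨e, he⟩, (ε j : ℝ) * x k j := by simp
    rw [← Finset.sum_add_distrib, hrange, Finset.mul_sum,
      ← Finset.sum_subset (Finset.subset_univ (Finset.univ.map ⟨e, he⟩))]
    · refine Finset.sum_congr rfl fun j hj => ?_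
      have hτj : τ j = 1 := if_pos (by simpa using hj)
      simp [hτj, two_mul]
    · intro j _ hj
      have hτj : τ j = -1 := if_neg (by simpa using hj)
      simp [hτj]
  refine le_of_mul_le_mul_left ?_ (zero_lt_two' ℝ)
  rw [← expect_comp_injective he, Finset.mul_expect, two_mul]
  nth_rw 3 [← expect_mul_left τ]
  rw [← Finset.expect_add_distrib]
  have hle (k : K) (η : J' → ℤˣ) :
      ∑ j, (η j : ℝ) * x k j ≤ ⨆ k, |∑ j, (η j : ℝ) * x k j| :=
    (le_abs_self _).trans (Finite.le_ciSup (fun k => |∑ j, (η j : ℝ) * x k j|) k)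
  refine Finset.expect_le_expect fun ε _ => ?_
  obtain ⟨k, hk⟩ := exists_eq_ciSup_of_finite (f := fun k => ∑ j, ((ε ∘ e) j : ℝ) * x k (e j))
  rw [← hk, hflip]
  exact add_le_add (hle k ε) (hle k (τ * ε))

end Signs

section Symmetrization

variable {J K 𝓦 Ω : Type*} [MeasurableSpace 𝓦] [MeasurableSpace Ω]

lemma integrable_ciSup_of_finite [Finite K] [Nonempty K] {μ : Measure Ω} {f : K → Ω → ℝ}
    (hf : ∀ k, Integrable (f k) μ) : Integrable (fun x => ⨆ k, f k x) μ := by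
  cases nonempty_fintype K
  refine (integrable_finsetSum Finset.univ fun k _ => (hf k).abs).mono'
    (AEMeasurable.iSup fun k => (hf k).aemeasurable).aestronglyMeasurable
    (Filter.Eventually.of_forall fun x => ?_)
  simpa using abs_iSup_le_sum_abs fun k => f k x

lemma integrable_expect {ι : Type*} {s : Finset ι} {μ : Measure Ω} {f : ι → Ω → ℝ}
    (hf : ∀ i ∈ s, Integrable (f i) μ) : Integrable (fun x => 𝔼 i ∈ s, f i x) μ := by
  simp only [Finset.expect_eq_sum_div_card]
  exact (integrable_finsetSum _ hf).div_const _

lemma integral_expect {ι : Type*} {s : Finset ι} {μ : Measure Ω} {f : ι → Ω → ℝ}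
    (hf : ∀ i ∈ s, Integrable (f i) μ) : ∫ x, 𝔼 i ∈ s, f i x ∂μ = 𝔼 i ∈ s, ∫ x, f i x ∂μ := by
  simp only [Finset.expect_eq_sum_div_card, integral_div, integral_finsetSum _ hf]

lemma integral_comp_of_measurePreserving {Ω' : Type*} [MeasurableSpace Ω'] {μ : Measure Ω}
    {μ' : Measure Ω'} {T : Ω → Ω'} (hT : MeasurePreserving T μ μ') {f : Ω' → ℝ}
    (hf : AEStronglyMeasurable f μ') : ∫ x, f (T x) ∂μ = ∫ y, f y ∂μ' := by
  rw [← hT.map_eq] at hf ⊢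
  exact (integral_map hT.aemeasurable hf).symm

variable [Fintype J] {ν : Measure 𝓦} [IsProbabilityMeasure ν]

lemma measurePreserving_comp_injective {J' : Type*} [Fintype J'] {e : J → J'}
    (he : Function.Injective e) : MeasurePreserving (fun (w : J' → 𝓦) j => w (e j))
      (Measure.pi fun _ => ν) (Measure.pi fun _ => ν) := by
  refine ⟨by fun_prop, ?_⟩
  simpa only [Measure.infinitePi_eq_pi] using
    Measure.map_infinitePi_infinitePi_of_inj (P := fun _ : J' => ν) he

/-- The expectation of `sup_k ∑ⱼ aⱼ h_k(wⱼ)`, where the `wⱼ` are independent with law `ν`. -/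
noncomputable def weightedSup (ν : Measure 𝓦) (h : K → 𝓦 → ℝ) (a : J → ℝ) : ℝ :=
  ∫ w : J → 𝓦, ⨆ k, ∑ j, a j * h k (w j) ∂(Measure.pi fun _ => ν)

/-- The Rademacher average `E sup_k ∑ⱼ εⱼ h_k(wⱼ)` (no absolute value, no normalization) over a
sample indexed by `J`, where `εⱼ` are independent uniform signs. -/
noncomputable def rademacherAvg (J : Type*) [Fintype J] [DecidableEq J] (ν : Measure 𝓦)
    (h : K → 𝓦 → ℝ) : ℝ :=
  𝔼 ε : J → ℤˣ, weightedSup ν h fun j => (ε j : ℝ)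

lemma integrable_sum_mul_eval {h : K → 𝓦 → ℝ} (hh : ∀ k, Integrable (h k) ν) (a : J → ℝ) (k : K) :
    Integrable (fun w : J → 𝓦 => ∑ j, a j * h k (w j)) (Measure.pi fun _ => ν) :=
  integrable_finsetSum _ fun _ _ => (integrable_comp_eval (hh k)).const_mul _

variable [Finite K] [Nonempty K] {h : K → 𝓦 → ℝ}

lemma integrable_iSup_sum_mul_eval (hh : ∀ k, Integrable (h k) ν) (a : J → ℝ) :
    Integrable (fun w : J → 𝓦 => ⨆ k, ∑ j, a j * h k (w j)) (Measure.pi fun _ => ν) :=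
  integrable_ciSup_of_finite fun k => integrable_sum_mul_eval hh a k

lemma integrable_sub_prod {g : 𝓦 → ℝ} (hg : Integrable g ν) :
    Integrable (fun z : 𝓦 × 𝓦 => g z.1 - g z.2) (ν.prod ν) :=
  (hg.comp_fst ν).sub (hg.comp_snd ν)

lemma weightedSup_prod_sub_mul_sign (hh : ∀ k, Integrable (h k) ν) (a : J → ℝ) (ε : J → ℤˣ) :
    weightedSup (ν.prod ν) (fun k z => h k z.1 - h k z.2) (fun j => a j * ε j) =
      weightedSup (ν.prod ν) (fun k z => h k z.1 - h k z.2) a := by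
  let T : (J → 𝓦 × 𝓦) → (J → 𝓦 × 𝓦) := fun z j => if ε j = 1 then z j else (z j).swap
  have hT : MeasurePreserving T (Measure.pi fun _ => ν.prod ν) (Measure.pi fun _ => ν.prod ν) := by
    refine measurePreserving_pi (fun _ : J => ν.prod ν) (fun _ : J => ν.prod ν)
      (f := fun j x => if ε j = 1 then x else x.swap) fun j => ?_
    by_cases hj : ε j = 1
    · simp only [hj, if_true]
      exact MeasurePreserving.id _
    · simpa [hj] using Measure.measurePreserving_swap
  unfold weightedSup
  rw [← integral_comp_of_measurePreserving hT
    (integrable_iSup_sum_mul_eval (fun k => integrable_sub_prod (hh k)) a).aestronglyMeasurable]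
  refine integral_congr_ae (.of_forall fun z => iSup_congr fun k =>
    Finset.sum_congr rfl fun j _ => ?_)
  rcases Int.units_eq_one_or (ε j) with hj | hj
  · simp [T, hj]
  · have hTz : T z j = (z j).swap := if_neg (by rw [hj]; decide)
    simp only [hTz, hj, Prod.fst_swap, Prod.snd_swap]
    push_cast
    ring

lemma weightedSup_sub_integral_le (hh : ∀ k, Integrable (h k) ν) (a : J → ℝ) :
    weightedSup ν (fun k w => h k w - ∫ x, h k x ∂ν) a ≤
      weightedSup (ν.prod ν) (fun k z => h k z.1 - h k z.2) a := by
  have hsplit := (measurePreserving_arrowProdEquivProdArrow 𝓦 𝓦 J (fun _ => ν) (fun _ => ν)).symm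
  have hint := integrable_iSup_sum_mul_eval (J := J) (fun k => integrable_sub_prod (hh k)) a
  have hint' : Integrable (fun z : (J → 𝓦) × (J → 𝓦) =>
      ⨆ k, ∑ j, a j * (h k (z.1 j) - h k (z.2 j)))
      ((Measure.pi fun _ => ν).prod (Measure.pi fun _ => ν)) :=
    hsplit.integrable_comp_of_integrable hint
  have hghost (w : J → 𝓦) (k : K) (j : J) : Integrable
      (fun w' : J → 𝓦 => a j * (h k (w j) - h k (w' j))) (Measure.pi fun _ => ν) :=
    ((integrable_const _).sub (integrable_comp_eval (hh k))).const_mul _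
  have hcond (w : J → 𝓦) (k : K) : ∑ j, a j * (h k (w j) - ∫ x, h k x ∂ν) =
      ∫ w' : J → 𝓦, ∑ j, a j * (h k (w j) - h k (w' j)) ∂(Measure.pi fun _ => ν) := by
    rw [integral_finsetSum _ fun j _ => hghost w k j]
    refine Finset.sum_congr rfl fun j _ => ?_
    rw [integral_const_mul, integral_sub (integrable_const _) (integrable_comp_eval (hh k)),
      integral_comp_eval (hh k).aestronglyMeasurable]
    simp
  unfold weightedSup
  rw [← integral_comp_of_measurePreserving hsplit hint.aestronglyMeasurable]
  refine le_trans ?_ (integral_prod _ hint').ge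
  refine integral_mono
    (integrable_iSup_sum_mul_eval (fun k => (hh k).sub (integrable_const _)) a)
    hint'.integral_prod_left fun w => ciSup_le fun k => ?_
  rw [hcond]
  exact integral_mono (integrable_finsetSum _ fun j _ => hghost w k j)
    (integrable_ciSup_of_finite fun k => integrable_finsetSum _ fun j _ => hghost w k j)
    fun w' => Finite.le_ciSup (fun k => ∑ j, a j * (h k (w j) - h k (w' j))) k

lemma weightedSup_prod_sub_le (hh : ∀ k, Integrable (h k) ν) (a : J → ℝ) :
    weightedSup (ν.prod ν) (fun k z => h k z.1 - h k z.2) a ≤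
      weightedSup ν h a + weightedSup ν h (fun j => -a j) := by
  have hfst : MeasurePreserving (fun (z : J → 𝓦 × 𝓦) j => (z j).1)
      (Measure.pi fun _ => ν.prod ν) (Measure.pi fun _ => ν) :=
    measurePreserving_pi (fun _ : J => ν.prod ν) (fun _ : J => ν) (f := fun _ => Prod.fst)
      fun _ => measurePreserving_fst
  have hsnd : MeasurePreserving (fun (z : J → 𝓦 × 𝓦) j => (z j).2)
      (Measure.pi fun _ => ν.prod ν) (Measure.pi fun _ => ν) :=
    measurePreserving_pi (fun _ : J => ν.prod ν) (fun _ : J => ν) (f := fun _ => Prod.snd)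
      fun _ => measurePreserving_snd
  have hint := integrable_iSup_sum_mul_eval (J := J) hh a
  have hint_neg := integrable_iSup_sum_mul_eval (J := J) hh (fun j => -a j)
  have hint₁ : Integrable (fun z : J → 𝓦 × 𝓦 => ⨆ k, ∑ j, a j * h k (z j).1)
      (Measure.pi fun _ => ν.prod ν) := hfst.integrable_comp_of_integrable hint
  have hint₂ : Integrable (fun z : J → 𝓦 × 𝓦 => ⨆ k, ∑ j, -a j * h k (z j).2)
      (Measure.pi fun _ => ν.prod ν) := hsnd.integrable_comp_of_integrable hint_neg
  unfold weightedSup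
  rw [← integral_comp_of_measurePreserving hfst hint.aestronglyMeasurable,
    ← integral_comp_of_measurePreserving hsnd hint_neg.aestronglyMeasurable,
    ← integral_add hint₁ hint₂]
  refine integral_mono (integrable_iSup_sum_mul_eval (fun k => integrable_sub_prod (hh k)) a)
    (hint₁.add hint₂) fun z => ciSup_le fun k => ?_
  calc ∑ j, a j * (h k (z j).1 - h k (z j).2)
      = ∑ j, a j * h k (z j).1 + ∑ j, -a j * h k (z j).2 := by
        rw [← Finset.sum_add_distrib]
        exact Finset.sum_congr rfl fun j _ => by ring
    _ ≤ _ := add_le_add (Finite.le_ciSup (fun k => ∑ j, a j * h k (z j).1) k)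
        (Finite.le_ciSup (fun k => ∑ j, -a j * h k (z j).2) k)

variable [DecidableEq J]

theorem weightedSup_sub_integral_le_rademacherAvg (hh : ∀ k, Integrable (h k) ν) (a : J → ℤˣ) :
    weightedSup ν (fun k w => h k w - ∫ x, h k x ∂ν) (fun j => (a j : ℝ)) ≤
      2 * rademacherAvg J ν h := by
  have hsymm (ε : J → ℤˣ) : weightedSup (ν.prod ν) (fun k z => h k z.1 - h k z.2)
      (fun j => (a j : ℝ)) = weightedSup (ν.prod ν) (fun k z => h k z.1 - h k z.2)
        fun j => (ε j : ℝ) := by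
    rw [← weightedSup_prod_sub_mul_sign hh (fun j => (ε j : ℝ)) (ε * a)]
    congr 1
    ext j
    rcases Int.units_eq_one_or (ε j) with h | h <;> simp [h]
  have hneg : 𝔼 ε : J → ℤˣ, weightedSup ν h (fun j => -(ε j : ℝ)) = rademacherAvg J ν h :=
    Fintype.expect_equiv (Equiv.neg _) _ _ fun ε => by simp
  calc weightedSup ν (fun k w => h k w - ∫ x, h k x ∂ν) (fun j => (a j : ℝ))
      ≤ weightedSup (ν.prod ν) (fun k z => h k z.1 - h k z.2) (fun j => (a j : ℝ)) :=
        weightedSup_sub_integral_le hh _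
    _ = 𝔼 ε : J → ℤˣ, weightedSup (ν.prod ν) (fun k z => h k z.1 - h k z.2)
          fun j => (ε j : ℝ) := by
        rw [← Finset.expect_congr rfl fun ε _ => hsymm ε, Fintype.expect_const]
    _ ≤ 𝔼 ε : J → ℤˣ, (weightedSup ν h (fun j => (ε j : ℝ)) +
          weightedSup ν h fun j => -(ε j : ℝ)) :=
        Finset.expect_le_expect fun ε _ => weightedSup_prod_sub_le hh _
    _ = 2 * rademacherAvg J ν h := by
        rw [Finset.expect_add_distrib, hneg, rademacherAvg, two_mul]

lemma rademacherAvg_eq_integral (hh : ∀ k, Integrable (h k) ν) :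
    rademacherAvg J ν h = ∫ w : J → 𝓦, 𝔼 ε : J → ℤˣ, ⨆ k, ∑ j, (ε j : ℝ) * h k (w j)
      ∂(Measure.pi fun _ => ν) :=
  (integral_expect fun _ _ => integrable_iSup_sum_mul_eval hh _).symm

theorem rademacherAvg_abs_le (hh : ∀ k, Integrable (h k) ν) :
    rademacherAvg J ν (fun k w => |h k w|) ≤ rademacherAvg J ν h := by
  rw [rademacherAvg_eq_integral hh, rademacherAvg_eq_integral fun k => (hh k).abs]
  exact integral_mono
    (integrable_expect fun _ _ => integrable_iSup_sum_mul_eval (fun k => (hh k).abs) _)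
    (integrable_expect fun _ _ => integrable_iSup_sum_mul_eval hh _)
    fun w => expect_iSup_sum_sign_mul_abs_le fun k j => h k (w j)

theorem integral_iSup_sum_abs_le (hh : ∀ k, Integrable (h k) ν) {c : ℝ}
    (hc : ∀ k, ∫ w, |h k w| ∂ν ≤ c) :
    ∫ w : J → 𝓦, ⨆ k, ∑ j, |h k (w j)| ∂(Measure.pi fun _ => ν) ≤
      Fintype.card J * c + 2 * rademacherAvg J ν h := by
  let Z : K → 𝓦 → ℝ := fun k w => |h k w| - ∫ w, |h k w| ∂ν
  have hint : Integrable (fun w : J → 𝓦 => ⨆ k, ∑ j, ((1 : J → ℤˣ) j : ℝ) * Z k (w j))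
      (Measure.pi fun _ => ν) :=
    integrable_iSup_sum_mul_eval (fun k => (hh k).abs.sub (integrable_const _)) _
  have hcentre : ∫ w : J → 𝓦, ⨆ k, ∑ j, |h k (w j)| ∂(Measure.pi fun _ => ν) ≤
      Fintype.card J * c + weightedSup ν Z fun j => ((1 : J → ℤˣ) j : ℝ) := by
    have hconst : ∫ _ : J → 𝓦, (Fintype.card J * c : ℝ) ∂(Measure.pi fun _ => ν) =
        Fintype.card J * c := by simp
    rw [weightedSup, ← hconst, ← integral_add (integrable_const _) hint]
    refine integral_mono (integrable_ciSup_of_finite fun k => integrable_finsetSum _ fun j _ =>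
      (integrable_comp_eval (hh k)).abs) ((integrable_const _).add hint)
      fun w => ciSup_le fun k => ?_
    have hk := Finite.le_ciSup (fun k => ∑ j, ((1 : J → ℤˣ) j : ℝ) * Z k (w j)) k
    have hsum : ∑ j, ((1 : J → ℤˣ) j : ℝ) * Z k (w j) =
        ∑ j, |h k (w j)| - Fintype.card J * ∫ w, |h k w| ∂ν := by
      simp [Z]
    have hmean := mul_le_mul_of_nonneg_left (hc k) (Nat.cast_nonneg (α := ℝ) (Fintype.card J))
    dsimp only at hk ⊢
    linarith
  have hsymm := weightedSup_sub_integral_le_rademacherAvg (fun k => (hh k).abs) (1 : J → ℤˣ)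
  linarith [rademacherAvg_abs_le (J := J) hh]

lemma rademacherAvg_le_of_injective {J' : Type*} [Fintype J'] [DecidableEq J'] {e : J → J'}
    (he : Function.Injective e) (hh : ∀ k, Integrable (h k) ν) :
    rademacherAvg J ν h ≤ 𝔼 ε : J' → ℤˣ,
      ∫ w : J' → 𝓦, ⨆ k, |∑ j, (ε j : ℝ) * h k (w j)| ∂(Measure.pi fun _ => ν) := by
  have hmp := measurePreserving_comp_injective (ν := ν) he
  have hint : Integrable (fun w : J → 𝓦 => 𝔼 ε : J → ℤˣ, ⨆ k, ∑ j, (ε j : ℝ) * h k (w j))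
      (Measure.pi fun _ => ν) :=
    integrable_expect fun _ _ => integrable_iSup_sum_mul_eval hh _
  have hint' (ε : J' → ℤˣ) : Integrable (fun w : J' → 𝓦 => ⨆ k, |∑ j, (ε j : ℝ) * h k (w j)|)
      (Measure.pi fun _ => ν) :=
    integrable_ciSup_of_finite fun k => (integrable_sum_mul_eval hh _ k).abs
  rw [rademacherAvg_eq_integral hh, ← integral_expect fun ε _ => hint' ε,
    ← integral_comp_of_measurePreserving hmp hint.aestronglyMeasurable]
  exact integral_mono (hmp.integrable_comp_of_integrable hint)
    (integrable_expect fun ε _ => hint' ε)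
    fun w => expect_iSup_sum_sign_mul_le_of_injective he fun k j => h k (w j)

end Symmetrization

section BoundedDifferences

variable {𝓦 Ω Ω' : Type*} [MeasurableSpace 𝓦] [MeasurableSpace Ω] [MeasurableSpace Ω']
  {ν : Measure 𝓦} {μ : Measure Ω} {μ' : Measure Ω'}

lemma hasSubgaussianMGF_sub_integral_of_abs_sub_le [IsProbabilityMeasure ν] {g : 𝓦 → ℝ}
    (hg : AEMeasurable g ν) {c : NNReal} (hd : ∀ w w', |g w - g w'| ≤ c) :
    HasSubgaussianMGF (fun w => g w - ∫ x, g x ∂ν) ((c / 2) ^ 2) ν := by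
  have := ν.nonempty_of_neZero
  have hbdd : BddBelow (Set.range g) :=
    ⟨g (Classical.arbitrary 𝓦) - c, by
      rintro _ ⟨w, rfl⟩
      linarith [(abs_le.1 (hd (Classical.arbitrary 𝓦) w)).2]⟩
  have hmem (w : 𝓦) : g w ∈ Set.Icc (⨅ w, g w) ((⨅ w, g w) + c) :=
    ⟨ciInf_le hbdd w, by
      have : g w - c ≤ ⨅ w, g w := le_ciInf fun w' => by linarith [(abs_le.1 (hd w w')).2]
      linarith⟩
  simpa using hasSubgaussianMGF_of_mem_Icc hg (.of_forall hmem)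

lemma hasSubgaussianMGF_fst_add [SFinite μ] [SFinite μ'] {X : Ω → ℝ} {Y : Ω × Ω' → ℝ}
    {c c' : NNReal}
    (hint : ∀ t, Integrable (fun p : Ω × Ω' => Real.exp (t * (X p.1 + Y p))) (μ.prod μ'))
    (hX : HasSubgaussianMGF X c μ) (hY : ∀ x, HasSubgaussianMGF (fun y => Y (x, y)) c' μ') :
    HasSubgaussianMGF (fun p => X p.1 + Y p) (c + c') (μ.prod μ') where
  integrable_exp_mul := hint
  mgf_le t := calc
    mgf (fun p => X p.1 + Y p) (μ.prod μ') t
      = ∫ x, Real.exp (t * X x) * mgf (fun y => Y (x, y)) μ' t ∂μ := by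
        rw [mgf, integral_prod _ (hint t)]
        simp only [mul_add, Real.exp_add, integral_const_mul, mgf]
    _ ≤ ∫ x, Real.exp (t * X x) * Real.exp (c' * t ^ 2 / 2) ∂μ := by
        refine integral_mono_of_nonneg (.of_forall fun x => ?_)
          ((hX.integrable_exp_mul t).mul_const _) (.of_forall fun x => ?_)
        · exact mul_nonneg (Real.exp_nonneg _) mgf_nonneg
        · exact mul_le_mul_of_nonneg_left ((hY x).mgf_le t) (Real.exp_nonneg _)
    _ ≤ Real.exp (c * t ^ 2 / 2) * Real.exp (c' * t ^ 2 / 2) := by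
        rw [integral_mul_const]
        exact mul_le_mul_of_nonneg_right (hX.mgf_le t) (Real.exp_nonneg _)
    _ = Real.exp ((c + c' : NNReal) * t ^ 2 / 2) := by
        rw [← Real.exp_add]
        push_cast
        ring_nf

lemma hasSubgaussianMGF_sub_integral_prod [SFinite μ] [SFinite μ'] {F : Ω × Ω' → ℝ}
    {c c' : NNReal} (hF : Integrable F (μ.prod μ'))
    (hexp : ∀ M t, Integrable (fun p => Real.exp (t * (F p - M))) (μ.prod μ'))
    (hfst : HasSubgaussianMGF (fun x => ∫ y, F (x, y) ∂μ' - ∫ x, ∫ y, F (x, y) ∂μ' ∂μ) c μ)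
    (hsnd : ∀ x, HasSubgaussianMGF (fun y => F (x, y) - ∫ y, F (x, y) ∂μ') c' μ') :
    HasSubgaussianMGF (fun p => F p - ∫ p, F p ∂μ.prod μ') (c + c') (μ.prod μ') := by
  rw [integral_prod _ hF]
  simpa only [sub_add_sub_cancel'] using hasSubgaussianMGF_fst_add
    (Y := fun p => F p - ∫ y, F (p.1, y) ∂μ')
    (fun t => by simpa only [sub_add_sub_cancel'] using hexp _ t) hfst hsnd

lemma abs_sub_le_sum_of_bounded_differences {E : Type*} {n : ℕ} {f : (Fin n → E) → ℝ}
    {c : Fin n → NNReal}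
    (hd : ∀ x i w, |f (Function.update x i w) - f x| ≤ c i) (x y : Fin n → E) :
    |f x - f y| ≤ ∑ i, (c i : ℝ) := by
  induction n with
  | zero => simp [Subsingleton.elim x y]
  | succ n ih =>
    have htail := ih (f := fun z => f (Fin.cons (y 0) z)) (c := fun i => c i.succ)
      (fun z i w => by simpa only [Fin.cons_update] using hd (Fin.cons (y 0) z) i.succ w)
      (Fin.tail x) (Fin.tail y)
    have hhead := hd x 0 (y 0)
    rw [← Fin.cons_self_tail x, Fin.update_cons_zero, abs_sub_comm] at hhead
    simp only [Fin.cons_self_tail] at hhead htail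
    rw [Fin.sum_univ_succ]
    exact (abs_sub_le _ (f (Fin.cons (y 0) (Fin.tail x))) _).trans (add_le_add hhead htail)

lemma measurePreserving_cons [SigmaFinite ν] (n : ℕ) :
    MeasurePreserving (fun p : 𝓦 × (Fin n → 𝓦) => (Fin.cons p.1 p.2 : Fin (n + 1) → 𝓦))
      (ν.prod (Measure.pi fun _ => ν)) (Measure.pi fun _ => ν) := by
  convert (measurePreserving_piFinSuccAbove (fun _ : Fin (n + 1) => ν) 0).symm using 1
  ext p : 1
  simp [MeasurableEquiv.piFinSuccAbove]
  rfl

variable [IsProbabilityMeasure ν]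

lemma integrable_of_bounded_differences {n : ℕ} {f : (Fin n → 𝓦) → ℝ} (hf : Measurable f)
    {c : Fin n → NNReal} (hd : ∀ x i w, |f (Function.update x i w) - f x| ≤ c i) :
    Integrable f (Measure.pi fun _ => ν) := by
  obtain ⟨x₀⟩ := (Measure.pi fun _ : Fin n => ν).nonempty_of_neZero
  refine Integrable.of_bound hf.aestronglyMeasurable (|f x₀| + ∑ i, (c i : ℝ))
    (.of_forall fun x => ?_)
  have := abs_sub_abs_le_abs_sub (f x) (f x₀)
  rw [Real.norm_eq_abs]
  linarith [abs_sub_le_sum_of_bounded_differences hd x x₀]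

lemma integrable_exp_mul_of_bounded_differences {n : ℕ} {f : (Fin n → 𝓦) → ℝ} (hf : Measurable f)
    {c : Fin n → NNReal} (hd : ∀ x i w, |f (Function.update x i w) - f x| ≤ c i) (M t : ℝ) :
    Integrable (fun x => Real.exp (t * (f x - M))) (Measure.pi fun _ => ν) := by
  obtain ⟨x₀⟩ := (Measure.pi fun _ : Fin n => ν).nonempty_of_neZero
  refine integrable_exp_mul_of_mem_Icc (a := f x₀ - M - ∑ i, (c i : ℝ))
    (b := f x₀ - M + ∑ i, (c i : ℝ)) (hf.sub_const M).aemeasurable (.of_forall fun x => ?_)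
  have h := abs_le.1 (abs_sub_le_sum_of_bounded_differences hd x x₀)
  exact ⟨by linarith, by linarith⟩

theorem hasSubgaussianMGF_sub_integral_of_bounded_differences {n : ℕ} {f : (Fin n → 𝓦) → ℝ}
    (hf : Measurable f) {c : Fin n → NNReal}
    (hd : ∀ x i w, |f (Function.update x i w) - f x| ≤ c i) :
    HasSubgaussianMGF (fun x => f x - ∫ y, f y ∂(Measure.pi fun _ => ν)) (∑ i, (c i / 2) ^ 2)
      (Measure.pi fun _ => ν) := by
  induction n with
  | zero => simp [Subsingleton.elim _ (default : Fin 0 → 𝓦), HasSubgaussianMGF.fun_zero]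
  | succ n ih =>
    let Q : Measure (Fin n → 𝓦) := Measure.pi fun _ => ν
    let F : 𝓦 × (Fin n → 𝓦) → ℝ := fun p => f (Fin.cons p.1 p.2)
    have hcons := measurePreserving_cons (ν := ν) n
    have hF : Measurable F := hf.comp hcons.measurable
    have hF_sec (w : 𝓦) : Measurable fun y => F (w, y) := hF.comp measurable_prodMk_left
    have hd_sec (w : 𝓦) (y : Fin n → 𝓦) (i : Fin n) (v : 𝓦) :
        |F (w, Function.update y i v) - F (w, y)| ≤ c i.succ := by
      simpa only [F, Fin.cons_update] using hd (Fin.cons w y) i.succ v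
    have hF_int (w : 𝓦) : Integrable (fun y => F (w, y)) Q :=
      integrable_of_bounded_differences (hF_sec w) (hd_sec w)
    have hg : Measurable fun w => ∫ y, F (w, y) ∂Q :=
      (hF.stronglyMeasurable.integral_prod_right (ν := Q)).measurable
    have hg_osc (w w' : 𝓦) : |∫ y, F (w, y) ∂Q - ∫ y, F (w', y) ∂Q| ≤ c 0 := by
      have hle (y : Fin n → 𝓦) : ‖F (w, y) - F (w', y)‖ ≤ c 0 := by
        simpa only [F, Fin.update_cons_zero, Real.norm_eq_abs] using hd (Fin.cons w' y) 0 w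
      rw [← integral_sub (hF_int w) (hF_int w')]
      simpa using norm_integral_le_of_norm_le_const (μ := Q) (.of_forall hle)
    have hprod : HasSubgaussianMGF (fun p => F p - ∫ p, F p ∂ν.prod Q)
        ((c 0 / 2) ^ 2 + ∑ i : Fin n, (c i.succ / 2) ^ 2) (ν.prod Q) :=
      hasSubgaussianMGF_sub_integral_prod
        (hcons.integrable_comp_of_integrable (integrable_of_bounded_differences hf hd))
        (fun M t => hcons.integrable_comp_of_integrable
          (integrable_exp_mul_of_bounded_differences hf hd M t))
        (hasSubgaussianMGF_sub_integral_of_abs_sub_le hg.aemeasurable hg_osc)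
        fun w => ih (hF_sec w) (hd_sec w)
    rw [← Fin.sum_univ_succ (fun i => (c i / 2) ^ 2),
      integral_comp_of_measurePreserving hcons hf.aestronglyMeasurable] at hprod
    have hfM := hf.sub_const (∫ x, f x ∂(Measure.pi fun _ => ν))
    exact hprod.congr_identDistrib ⟨(hF.sub_const _).aemeasurable, hfM.aemeasurable,
      (Measure.map_map hfM hcons.measurable).symm.trans (by rw [hcons.map_eq])⟩

theorem measure_ge_le_of_bounded_differences {n : ℕ} {f : (Fin n → 𝓦) → ℝ} (hf : Measurable f)
    {c : Fin n → NNReal} (hd : ∀ x i w, |f (Function.update x i w) - f x| ≤ c i) {s : ℝ}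
    (hs : 0 ≤ s) :
    (Measure.pi fun _ => ν).real {x | (∫ y, f y ∂(Measure.pi fun _ => ν)) + s ≤ f x} ≤
      Real.exp (-(2 * s ^ 2 / ∑ i, (c i : ℝ) ^ 2)) := by
  simp only [← le_sub_iff_add_le']
  refine ((hasSubgaussianMGF_sub_integral_of_bounded_differences hf
    hd).measure_ge_le hs).trans_eq ?_
  push_cast
  simp only [div_pow, ← Finset.sum_div]
  ring_nf

end BoundedDifferences

section Exceedances

variable {K 𝓦 : Type*}

/-- The number of coordinates `j` such that `|Z (w j)| > t`. -/
noncomputable def exceedanceCount (Z : 𝓦 → ℝ) (t : ℝ) {n : ℕ} (w : Fin n → 𝓦) : ℕ :=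
  (Finset.univ.filter fun j => t < |Z (w j)|).card

lemma exceedanceCount_update_le {n : ℕ} (Z : 𝓦 → ℝ) (t : ℝ) (w : Fin n → 𝓦) (i : Fin n) (v : 𝓦) :
    exceedanceCount Z t (Function.update w i v) ≤ exceedanceCount Z t w + 1 := by
  refine (Finset.card_le_card (t := insert i
    (Finset.univ.filter fun j => t < |Z (w j)|)) fun j hj => ?_).trans
      (Finset.card_insert_le _ _)
  rcases eq_or_ne j i with rfl | hji
  · simp
  · simpa [hji] using hj

lemma mul_exceedanceCount_le_sum_abs {n : ℕ} (Z : 𝓦 → ℝ) (t : ℝ) (w : Fin n → 𝓦) :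
    t * exceedanceCount Z t w ≤ ∑ j, |Z (w j)| := by
  rw [exceedanceCount, mul_comm, ← nsmul_eq_mul]
  exact (Finset.card_nsmul_le_sum _ _ _ fun j hj => (Finset.mem_filter.1 hj).2.le).trans
    (Finset.sum_le_sum_of_subset_of_nonneg (Finset.filter_subset _ _) fun _ _ _ => abs_nonneg _)

lemma abs_iSup_exceedanceCount_update_sub_le [Finite K] [Nonempty K] {n : ℕ} (Z : K → 𝓦 → ℝ)
    (t : ℝ) (w : Fin n → 𝓦) (i : Fin n) (v : 𝓦) :
    |(⨆ k, (exceedanceCount (Z k) t (Function.update w i v) : ℝ)) -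
      ⨆ k, (exceedanceCount (Z k) t w : ℝ)| ≤ 1 := by
  have hle (w : Fin n → 𝓦) (v : 𝓦) :
      (⨆ k, (exceedanceCount (Z k) t (Function.update w i v) : ℝ)) ≤
        (⨆ k, (exceedanceCount (Z k) t w : ℝ)) + 1 := by
    refine ciSup_le fun k => ?_
    have hk := Finite.le_ciSup (fun k => (exceedanceCount (Z k) t w : ℝ)) k
    have hupdate : (exceedanceCount (Z k) t (Function.update w i v) : ℝ) ≤
        exceedanceCount (Z k) t w + 1 := mod_cast exceedanceCount_update_le (Z k) t w i v
    linarith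
  have hback := hle (Function.update w i v) (w i)
  rw [Function.update_idem, Function.update_eq_self] at hback
  rw [abs_le]
  exact ⟨by linarith, by linarith [hle w v]⟩

variable [MeasurableSpace 𝓦]

lemma measurable_exceedanceCount {n : ℕ} {Z : 𝓦 → ℝ} (hZ : Measurable Z) (t : ℝ) :
    Measurable fun w : Fin n → 𝓦 => (exceedanceCount Z t w : ℝ) := by
  simp only [exceedanceCount, Finset.card_filter, Nat.cast_sum, Nat.cast_ite, Nat.cast_one,
    Nat.cast_zero]
  refine Finset.measurable_sum _ fun j _ =>
    Measurable.ite (measurableSet_lt measurable_const ?_) measurable_const measurable_const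
  exact (hZ.comp (measurable_pi_apply j)).abs

variable {ν : Measure 𝓦} [IsProbabilityMeasure ν]

/-- Markov's inequality bounds the expected number of exceedances by `np`, and this number
satisfies the bounded differences condition. -/
theorem measure_exists_exceedanceCount_ge_le_of_finite [Finite K] [Nonempty K] {n : ℕ}
    {Z : K → 𝓦 → ℝ} (hZm : ∀ k, Measurable (Z k)) (hZ : ∀ k, Integrable (Z k) ν) {t p δ : ℝ}
    (ht : 0 < t) (hδ : 0 ≤ δ)
    (hp : ∫ w : Fin n → 𝓦, ⨆ k, ∑ j, |Z k (w j)| ∂(Measure.pi fun _ => ν) ≤ t * (n * p)) :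
    (Measure.pi fun _ => ν) {w : Fin n → 𝓦 | ∃ k, n * (p + δ) ≤ exceedanceCount (Z k) t w} ≤
      ENNReal.ofReal (Real.exp (-(2 * n * δ ^ 2))) := by
  let f : (Fin n → 𝓦) → ℝ := fun w => ⨆ k, (exceedanceCount (Z k) t w : ℝ)
  have hf : Measurable f := .iSup fun k => measurable_exceedanceCount (hZm k) t
  have hd (w : Fin n → 𝓦) (i : Fin n) (v : 𝓦) :
      |f (Function.update w i v) - f w| ≤ (1 : NNReal) := by
    simpa using abs_iSup_exceedanceCount_update_sub_le Z t w i v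
  have hmarkov : t * ∫ w, f w ∂(Measure.pi fun _ => ν) ≤ t * (n * p) := by
    refine le_trans ?_ hp
    rw [← integral_const_mul]
    refine integral_mono ((integrable_of_bounded_differences hf hd).const_mul t)
      (integrable_ciSup_of_finite fun k => integrable_finsetSum _ fun _ _ =>
        (integrable_comp_eval (hZ k)).abs) fun w => ?_
    rw [Real.mul_iSup_of_nonneg ht.le]
    exact Finite.ciSup_mono fun k => mul_exceedanceCount_le_sum_abs (Z k) t w
  have hmean := le_of_mul_le_mul_left hmarkov ht
  have hsub : {w : Fin n → 𝓦 | ∃ k, n * (p + δ) ≤ exceedanceCount (Z k) t w} ⊆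
      {w | ∫ w, f w ∂(Measure.pi fun _ => ν) + n * δ ≤ f w} := by
    rintro w ⟨k, hk⟩
    have := Finite.le_ciSup (fun k => (exceedanceCount (Z k) t w : ℝ)) k
    exact (by linarith : _ ≤ (exceedanceCount (Z k) t w : ℝ)).trans this
  refine (measure_mono hsub).trans ((ENNReal.le_ofReal_iff_toReal_le (by finiteness)
    (Real.exp_nonneg _)).2 ((measure_ge_le_of_bounded_differences hf hd (by positivity)).trans ?_))
  refine (Real.exp_le_exp.2 (le_of_eq ?_))
  rcases n.eq_zero_or_pos with rfl | hn
  · simp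
  · simp only [NNReal.coe_one, one_pow, Finset.sum_const, Finset.card_univ, Fintype.card_fin,
      nsmul_eq_mul, mul_one]
    field_simp

theorem measure_exists_exceedanceCount_ge_le {n : ℕ} {Z : ℕ → 𝓦 → ℝ}
    (hZm : ∀ k, Measurable (Z k)) (hZ : ∀ k, Integrable (Z k) ν) {t p δ : ℝ}
    (ht : 0 < t) (hδ : 0 ≤ δ) (hp : ∀ M : ℕ, ∫ w : Fin n → 𝓦, ⨆ k : Fin (M + 1), ∑ j, |Z k (w j)|
      ∂(Measure.pi fun _ => ν) ≤ t * (n * p)) :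
    (Measure.pi fun _ => ν) {w : Fin n → 𝓦 | ∃ k, n * (p + δ) ≤ exceedanceCount (Z k) t w} ≤
      ENNReal.ofReal (Real.exp (-(2 * n * δ ^ 2))) := by
  rw [Set.ofPred_exists, measure_iUnion_eq_iSup_accumulate]
  refine iSup_le fun M => (measure_mono fun w hw => ?_).trans
    (measure_exists_exceedanceCount_ge_le_of_finite (fun k : Fin (M + 1) => hZm k)
      (fun k => hZ k) ht hδ (hp M))
  obtain ⟨k, hk, hw⟩ := Set.mem_accumulate.1 hw
  exact ⟨⟨k, Nat.lt_succ_of_le hk⟩, hw⟩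

end Exceedances

section Blocks

variable {𝓩 : Type*} [MeasurableSpace 𝓩] {P : Measure 𝓩}

/-- The centred sum of `ψ` over a sample `B`. -/
noncomputable def centredSum (P : Measure 𝓩) {m : ℕ} (ψ : 𝓩 → ℝ) (B : Fin m → 𝓩) : ℝ :=
  ∑ i, (ψ (B i) - ∫ z, ψ z ∂P)

lemma measurable_centredSum {m : ℕ} {ψ : 𝓩 → ℝ} (hψ : Measurable ψ) :
    Measurable (centredSum P ψ : (Fin m → 𝓩) → ℝ) := by
  unfold centredSum; fun_prop

/-- Splits a sample of size at least `n * m` into `n` consecutive blocks of length `m`. -/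
def toBlocks {N n m : ℕ} (h : n * m ≤ N) (D : Fin N → 𝓩) : Fin n → Fin m → 𝓩 :=
  fun j i => D (Fin.castLE h (finProdFinEquiv (j, i)))

lemma blockMean_eq {N n m : ℕ} (h : n * m ≤ N) (v : Fin N → ℝ) (j : Fin n) :
    blockMean m v j = (m : ℝ)⁻¹ * ∑ i, toBlocks h v j i := by
  unfold blockMean
  congr 1
  symm
  refine Finset.sum_bij (fun i _ => Fin.castLE h (finProdFinEquiv (j, i))) (fun i _ => ?_)
    (fun i _ i' _ hi => ?_) (fun x hx => ?_) fun _ _ => rfl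
  · simp only [Finset.mem_filter, Finset.mem_univ, true_and, Fin.val_castLE,
      finProdFinEquiv_apply_val, mul_comm m, add_mul, one_mul]
    omega
  · simpa using hi
  · simp only [Finset.mem_filter, Finset.mem_univ, true_and, add_mul, one_mul] at hx
    refine ⟨⟨x - j * m, by omega⟩, Finset.mem_univ _, Fin.ext ?_⟩
    simp only [Fin.val_castLE, finProdFinEquiv_apply_val, mul_comm m]
    omega

lemma centredSum_toBlocks {N n m : ℕ} (h : n * m ≤ N) (hm : 0 < m) (ψ : 𝓩 → ℝ) (D : Fin N → 𝓩)
    (j : Fin n) : centredSum P ψ (toBlocks h D j) =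
      m * (blockMean m (fun i => ψ (D i)) j - ∫ z, ψ z ∂P) := by
  have hm' : (m : ℝ) ≠ 0 := mod_cast hm.ne'
  rw [blockMean_eq h, centredSum, Finset.sum_sub_distrib]
  simp [toBlocks, mul_sub, mul_inv_cancel_left₀ hm']

/-- The number of blocks on which the mean of `ψ` is not within `γ` of its expectation. -/
noncomputable def deviatingBlocks (P : Measure 𝓩) {N : ℕ} (n m : ℕ) (ψ : 𝓩 → ℝ) (γ : ℝ)
    (D : Fin N → 𝓩) : ℕ :=
  (Finset.univ.filter fun j : Fin n =>
    γ < |blockMean m (fun i => ψ (D i)) j - ∫ z, ψ z ∂P|).card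

lemma deviatingBlocks_eq_exceedanceCount {N n m : ℕ} (h : n * m ≤ N) (hm : 0 < m) (ψ : 𝓩 → ℝ)
    (γ : ℝ) (D : Fin N → 𝓩) :
    deviatingBlocks P n m ψ γ D = exceedanceCount (centredSum P ψ) (m * γ) (toBlocks h D) := by
  have hm' : (0 : ℝ) < m := mod_cast hm
  unfold deviatingBlocks exceedanceCount
  congr 1
  refine Finset.filter_congr fun j _ => ?_
  rw [centredSum_toBlocks h hm, abs_mul, abs_of_pos hm', mul_lt_mul_iff_right₀ hm']

lemma sq_integral_abs_le {Ω : Type*} [MeasurableSpace Ω] {μ : Measure Ω} [IsProbabilityMeasure μ]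
    {f : Ω → ℝ} (hf : MemLp f 2 μ) : (∫ x, |f x| ∂μ) ^ 2 ≤ ∫ x, f x ^ 2 ∂μ := by
  have hvar := variance_nonneg (|f|) μ
  rw [variance_eq_sub hf.abs] at hvar
  simpa using hvar

variable [IsProbabilityMeasure P]

lemma measurePreserving_curry {I J : Type*} [Fintype I] [Fintype J] :
    MeasurePreserving (fun (w : I × J → 𝓩) i j => w (i, j))
      (Measure.pi fun _ => P) (Measure.pi fun _ => Measure.pi fun _ => P) := by
  refine ⟨by fun_prop, ?_⟩
  have hcurry := Measure.infinitePi_map_curry fun (_ : I) (_ : J) => P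
  simp only [Measure.infinitePi_eq_pi] at hcurry
  exact hcurry

lemma measurePreserving_toBlocks {N n m : ℕ} (h : n * m ≤ N) :
    MeasurePreserving (toBlocks h : (Fin N → 𝓩) → _) (Measure.pi fun _ => P)
      (Measure.pi fun _ => Measure.pi fun _ => P) :=
  measurePreserving_curry.comp (measurePreserving_comp_injective
    ((Fin.castLE_injective h).comp finProdFinEquiv.injective))

lemma integrable_centredSum {m : ℕ} {ψ : 𝓩 → ℝ} (hψ : Integrable ψ P) :
    Integrable (centredSum P ψ : (Fin m → 𝓩) → ℝ) (Measure.pi fun _ => P) :=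
  integrable_finsetSum _ fun _ _ => (integrable_comp_eval hψ).sub (integrable_const _)

lemma integral_centredSum {m : ℕ} {ψ : 𝓩 → ℝ} (hψ : Integrable ψ P) :
    ∫ B : Fin m → 𝓩, centredSum P ψ B ∂(Measure.pi fun _ => P) = 0 := by
  have hX (i : Fin m) : Integrable (fun B : Fin m → 𝓩 => ψ (B i) - ∫ z, ψ z ∂P)
      (Measure.pi fun _ => P) := (integrable_comp_eval hψ).sub (integrable_const _)
  unfold centredSum
  rw [integral_finsetSum _ fun i _ => hX i]
  refine Finset.sum_eq_zero fun i _ => ?_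
  rw [integral_sub (integrable_comp_eval hψ) (integrable_const _),
    integral_comp_eval hψ.aestronglyMeasurable]
  simp

lemma integral_abs_centredSum_le {m : ℕ} {ψ : 𝓩 → ℝ} (hψ : MemLp ψ 2 P) {s : ℝ} (hs : 0 ≤ s)
    (hψs : ∫ z, ψ z ^ 2 ∂P ≤ s ^ 2) :
    ∫ B : Fin m → 𝓩, |centredSum P ψ B| ∂(Measure.pi fun _ => P) ≤ s * √m := by
  have hX : MemLp (fun z => ψ z - ∫ z, ψ z ∂P) 2 P := hψ.sub (memLp_const _)
  have hsum : MemLp (centredSum P ψ : (Fin m → 𝓩) → ℝ) 2 (Measure.pi fun _ => P) :=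
    memLp_finsetSum _ fun i _ => hX.comp_measurePreserving
      (measurePreserving_eval (fun _ : Fin m => P) i)
  have hvar : ∫ B : Fin m → 𝓩, centredSum P ψ B ^ 2 ∂(Measure.pi fun _ => P) ≤ m * s ^ 2 := by
    rw [← variance_of_integral_eq_zero hsum.aemeasurable
        (integral_centredSum (hψ.integrable one_le_two)),
      show centredSum P ψ = ∑ i : Fin m, fun B : Fin m → 𝓩 => ψ (B i) - ∫ z, ψ z ∂P by
        ext B; simp [centredSum],
      variance_sum_pi (X := fun _ z => ψ z - ∫ z, ψ z ∂P) fun _ => hX, Finset.sum_const,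
      Finset.card_univ, Fintype.card_fin, nsmul_eq_mul]
    refine mul_le_mul_of_nonneg_left ?_ (by positivity)
    rw [variance_sub_const hψ.aestronglyMeasurable]
    exact (variance_le_expectation_sq hψ.aestronglyMeasurable).trans hψs
  refine le_of_sq_le_sq ?_ (by positivity)
  rw [mul_pow, Real.sq_sqrt (by positivity), mul_comm]
  exact (sq_integral_abs_le hsum).trans hvar

lemma rademacherAvg_centredSum_le {K : Type*} [Finite K] [Nonempty K] {n m : ℕ} {ψ : K → 𝓩 → ℝ}
    (hψ : ∀ k, Integrable (ψ k) P) :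
    rademacherAvg (Fin n) (Measure.pi fun _ : Fin m => P) (fun k => centredSum P (ψ k)) ≤
      2 * rademacherAvg (Fin n × Fin m) P ψ := by
  rw [rademacherAvg]
  refine Finset.expect_le Finset.univ_nonempty fun ε _ => le_trans (le_of_eq ?_)
    (weightedSup_sub_integral_le_rademacherAvg hψ fun p : Fin n × Fin m => ε p.1)
  unfold weightedSup
  rw [← integral_comp_of_measurePreserving (measurePreserving_curry (P := P))
    (integrable_iSup_sum_mul_eval (fun k => integrable_centredSum (hψ k)) _).aestronglyMeasurable]
  refine integral_congr_ae (.of_forall fun w => iSup_congr fun k => ?_)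
  rw [Fintype.sum_prod_type]
  exact Finset.sum_congr rfl fun j _ => Finset.mul_sum _ _ _

lemma measurableSet_exists_le_deviatingBlocks {N n m : ℕ} (h : n * m ≤ N) (hm : 0 < m)
    {ψ : ℕ → 𝓩 → ℝ} (hψ : ∀ k, Measurable (ψ k)) (γ c : ℝ) :
    MeasurableSet {D : Fin N → 𝓩 | ∃ k, c ≤ deviatingBlocks P n m (ψ k) γ D} := by
  simp_rw [deviatingBlocks_eq_exceedanceCount h hm, Set.ofPred_exists]
  exact .iUnion fun k => measurableSet_le measurable_const
    ((measurable_exceedanceCount (measurable_centredSum (hψ k)) _).comp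
      (measurePreserving_toBlocks (P := P) h).measurable)

theorem measure_exists_deviatingBlocks_ge_le {N n m : ℕ} (h : n * m ≤ N) (hm : 0 < m)
    {ψ : ℕ → 𝓩 → ℝ} (hψm : ∀ k, Measurable (ψ k)) (hψ : ∀ k, MemLp (ψ k) 2 P) {s b γ : ℝ}
    (hs : 0 ≤ s) (hγ : 0 < γ) (hψs : ∀ k, ∫ z, ψ k z ^ 2 ∂P ≤ s ^ 2)
    (hb : ∀ M : ℕ, rademacherAvg (Fin n × Fin m) P (fun k : Fin (M + 1) => ψ k) ≤ n * m * b)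
    (hsb : s / √m + 4 * b ≤ γ / 20) :
    (Measure.pi fun _ => P)
      {D : Fin N → 𝓩 | ∃ k, (n : ℝ) / 10 ≤ deviatingBlocks P n m (ψ k) γ D} ≤
      ENNReal.ofReal (Real.exp (-(n / 200))) := by
  have hψi (k : ℕ) : Integrable (ψ k) P := (hψ k).integrable one_le_two
  have hmean (M : ℕ) : ∫ B : Fin n → Fin m → 𝓩, ⨆ k : Fin (M + 1), ∑ j, |centredSum P (ψ k) (B j)|
      ∂(Measure.pi fun _ => Measure.pi fun _ => P) ≤ m * γ * (n * (1 / 20)) :=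
    calc _ ≤ n * (s * √m) + 2 * rademacherAvg (Fin n) (Measure.pi fun _ : Fin m => P)
            (fun k : Fin (M + 1) => centredSum P (ψ k)) := by
          simpa using integral_iSup_sum_abs_le (J := Fin n)
            (fun k : Fin (M + 1) => integrable_centredSum (m := m) (hψi k))
            fun k => integral_abs_centredSum_le (hψ k) hs (hψs k)
      _ ≤ n * (s * √m) + 4 * (n * m * b) := by
          linarith [hb M, rademacherAvg_centredSum_le (n := n) (m := m)
            fun k : Fin (M + 1) => hψi k]
      _ = n * m * (s / √m + 4 * b) := by
          rw [show s * √m = m * (s / √m) by rw [mul_div_left_comm, Real.div_sqrt]]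
          ring
      _ ≤ n * m * (γ / 20) := by gcongr
      _ = m * γ * (n * (1 / 20)) := by ring
  have hblocks := measurePreserving_toBlocks (P := P) h
  calc _ = (Measure.pi fun _ => P) (toBlocks h ⁻¹' {B : Fin n → Fin m → 𝓩 | ∃ k,
          n * (1 / 20 + 1 / 20) ≤ (exceedanceCount (centredSum P (ψ k)) (m * γ) B : ℝ)}) := by
        simp only [deviatingBlocks_eq_exceedanceCount h hm, Set.preimage_ofPred_eq]
        norm_num [div_eq_mul_inv]
    _ ≤ (Measure.pi fun _ => Measure.pi fun _ => P) _ := by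
        rw [← hblocks.map_eq]
        exact Measure.le_map_apply hblocks.aemeasurable _
    _ ≤ ENNReal.ofReal (Real.exp (-(2 * n * (1 / 20) ^ 2))) :=
        measure_exists_exceedanceCount_ge_le (fun k => measurable_centredSum (hψm k))
          (fun k => integrable_centredSum (hψi k)) (by positivity) (by norm_num) hmean
    _ = ENNReal.ofReal (Real.exp (-(n / 200))) := by ring_nf

end Blocks

section Median

open Filter Topology
open scoped Finset

variable {k : ℕ}

lemma exists_median (hk : 0 < k) (z : Fin k → ℝ) :
    ∃ t : ℝ, k ≤ 2 * #{j | z j ≤ t} ∧ k ≤ 2 * #{j | t ≤ z j} := by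
  have : Nonempty (Fin k) := ⟨⟨0, hk⟩⟩
  let S : Finset (Fin k) := {j | k ≤ 2 * #{i | z i ≤ z j}}
  have mem_S {j} : j ∈ S ↔ k ≤ 2 * #{i | z i ≤ z j} := Finset.mem_filter_univ j
  have hS : S.Nonempty := by
    obtain ⟨j, hj⟩ := Finite.exists_max z
    refine ⟨j, mem_S.2 ?_⟩
    rw [Finset.filter_true_of_mem fun i _ => hj i, Finset.card_univ, Fintype.card_fin]
    lia
  obtain ⟨j, hjS, hj⟩ := S.exists_min_image z hS
  refine ⟨z j, mem_S.1 hjS, ?_⟩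
  -- Otherwise the largest value below `z j` would be attained in `S` too.
  by_contra! hlt
  let T : Finset (Fin k) := {i | z i < z j}
  have hsplit : #{i | z j ≤ z i} + #T = k := by
    simpa only [not_le, Finset.card_univ, Fintype.card_fin] using
      Finset.card_filter_add_card_filter_not (s := Finset.univ) fun i => z j ≤ z i
  obtain ⟨i, hiT, hi⟩ := T.exists_max_image z (Finset.card_pos.1 (by lia))
  have hT : #T ≤ #{l | z l ≤ z i} :=
    Finset.card_le_card fun l hl => (Finset.mem_filter_univ l).2 (hi l hl)
  exact (hj i (mem_S.2 (by lia))).not_gt ((Finset.mem_filter_univ i).1 hiT)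

lemma smallestMedian_le (z : Fin k → ℝ) {c : ℝ} (hc : 2 * #{j | c < z j} < k) :
    smallestMedian z ≤ c := by
  have hk : 0 < k := Nat.zero_lt_of_lt hc
  have : Nonempty (Fin k) := ⟨⟨0, hk⟩⟩
  obtain ⟨t, ht⟩ := exists_median hk z
  have htc : t ≤ c := by
    by_contra! h
    have : #{j | t ≤ z j} ≤ #{j | c < z j} :=
      Finset.card_le_card (Finset.monotone_filter_right _ fun j _ => h.trans_le)
    lia
  obtain ⟨j, hj⟩ := Finite.exists_min z
  refine (csInf_le ⟨z j, fun s hs => ?_⟩ ht).trans htc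
  have hs : #{j | z j ≤ s} ≠ 0 := by have := hs.1; lia
  obtain ⟨i, hi⟩ := Finset.card_ne_zero.1 hs
  exact (hj i).trans ((Finset.mem_filter_univ i).1 hi)

lemma le_smallestMedian (z : Fin k → ℝ) {c : ℝ} (hc : 2 * #{j | z j ≤ c} < k) :
    c ≤ smallestMedian z := by
  refine le_csInf (exists_median (Nat.zero_lt_of_lt hc) z) fun t ht => ?_
  by_contra! h
  have : #{j | z j ≤ t} ≤ #{j | z j ≤ c} :=
    Finset.card_le_card (Finset.monotone_filter_right _ fun j _ hj => hj.trans h.le)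
  have := ht.1
  lia

lemma card_filter_le_of_tendsto {ι : Type*} [Fintype ι] {y : ℕ → ι → ℝ} {y₀ : ι → ℝ}
    (hy : ∀ j, Tendsto (fun k => y k j) atTop (𝓝 (y₀ j))) {c c' C : ℝ} (hc : c < c')
    (h : ∀ᶠ k in atTop, (#{j | c < y k j} : ℝ) ≤ C) : (#{j | c' ≤ y₀ j} : ℝ) ≤ C := by
  have hev : ∀ᶠ k in atTop, ∀ j, c' ≤ y₀ j → c < y k j := by
    simp only [eventually_all]
    exact fun j hj => (hy j).eventually (lt_mem_nhds (hc.trans_le hj))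
  obtain ⟨k, hk, hkC⟩ := (hev.and h).exists
  refine le_trans ?_ hkC
  exact_mod_cast Finset.card_le_card (Finset.monotone_filter_right _ fun j _ => hk j)

end Median

section Norms

open Filter Topology

variable {𝓩 : Type*} [MeasurableSpace 𝓩] {P : Measure 𝓩} {w : 𝓩 → ℝ}

lemma lpNorm_two_sq (hw : MemLp w 2 P) : lpNorm w 2 P ^ 2 = ∫ z, w z ^ 2 ∂P := by
  have h : 0 ≤ ∫ z, w z ^ 2 ∂P := integral_nonneg fun _ => sq_nonneg _
  rw [lpNorm_eq_integral_norm_rpow_toReal two_ne_zero ENNReal.ofNat_ne_top hw.aestronglyMeasurable]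
  simp only [ENNReal.toReal_ofNat, Real.rpow_ofNat, Real.norm_eq_abs, sq_abs]
  rw [← one_div, ← Real.sqrt_eq_rpow, Real.sq_sqrt h]

lemma lpNorm_const_mul_of_nonneg {c : ℝ} (hc : 0 ≤ c) (w : 𝓩 → ℝ) (p : ℝ≥0∞) :
    lpNorm (fun z => c * w z) p P = c * lpNorm w p P := by
  refine (lpNorm_const_smul c w P).trans ?_
  rw [coe_nnnorm, Real.norm_of_nonneg hc]

lemma integral_abs_le_lpNorm_two [IsProbabilityMeasure P] (hw : MemLp w 2 P) :
    ∫ z, |w z| ∂P ≤ lpNorm w 2 P :=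
  le_of_sq_le_sq ((sq_integral_abs_le hw).trans_eq (lpNorm_two_sq hw).symm) lpNorm_nonneg

lemma eLpNorm_two_rpow_le (hw : AEStronglyMeasurable w P) {q : ℝ} (hq : 2 < q) :
    eLpNorm w 2 P ^ (2 * (q - 1)) ≤
      eLpNorm w 1 P ^ (q - 2) * eLpNorm w (ENNReal.ofReal q) P ^ q := by
  have hq₀ : 0 < q := by linarith
  have hq₁ : 0 < q - 1 := by linarith
  have : 0 < q - 2 := by linarith
  have hpow : ∀ {p : ℝ}, 0 < p → eLpNorm w (ENNReal.ofReal p) P ^ p = ∫⁻ z, ‖w z‖ₑ ^ p ∂P := by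
    intro p hp
    rw [eLpNorm_eq_lintegral_rpow_enorm_toReal (by simpa using hp) ENNReal.ofReal_ne_top,
      ENNReal.toReal_ofReal hp.le, one_div, ENNReal.rpow_inv_rpow hp.ne']
  have hholder := ENNReal.lintegral_mul_norm_pow_le (μ := P) (f := fun z => ‖w z‖ₑ)
    (g := fun z => ‖w z‖ₑ ^ q) hw.enorm (hw.enorm.pow_const q) (p := (q - 2) / (q - 1))
    (q := (q - 1)⁻¹) (by positivity) (by positivity) (by field_simp; ring)
  have hsq : ∀ z, ‖w z‖ₑ ^ ((q - 2) / (q - 1)) * (‖w z‖ₑ ^ q) ^ (q - 1)⁻¹ = ‖w z‖ₑ ^ (2 : ℝ) := by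
    intro z
    rw [← ENNReal.rpow_mul, ← ENNReal.rpow_add_of_nonneg _ _ (by positivity) (by positivity)]
    congr 1
    field_simp
    ring
  simp only [hsq] at hholder
  have h1 := hpow one_pos
  have h2 := hpow two_pos
  simp only [ENNReal.ofReal_one, ENNReal.rpow_one, ENNReal.ofReal_ofNat] at h1 h2
  rw [← hpow hq₀, ← h1, ← h2] at hholder
  have := ENNReal.rpow_le_rpow hholder hq₁.le
  rwa [← ENNReal.rpow_mul, ENNReal.mul_rpow_of_nonneg _ _ hq₁.le, ← ENNReal.rpow_mul,
    ENNReal.rpow_inv_rpow hq₁.ne', div_mul_cancel₀ _ hq₁.ne'] at this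

/-- The constant with which an `L_q`-`L₂` norm equivalence with constant `L` bounds the `L₁` norm
from below by the `L₂` norm. -/
noncomputable def l1Ratio (q L : ℝ) : ℝ := (L ^ (q / (q - 2)))⁻¹

variable {q L : ℝ}

lemma l1Ratio_pos (hL : 1 ≤ L) : 0 < l1Ratio q L := by
  unfold l1Ratio
  positivity

lemma l1Ratio_le_one (hq : 2 < q) (hL : 1 ≤ L) : l1Ratio q L ≤ 1 :=
  inv_le_one_of_one_le₀ (Real.one_le_rpow hL (div_nonneg (by linarith) (by linarith)))

lemma eLpNorm_two_le_mul_eLpNorm_one (hw : MemLp w 2 P) (hq : 2 < q) (hL : 1 ≤ L)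
    (h : eLpNorm w (ENNReal.ofReal q) P ≤ ENNReal.ofReal L * eLpNorm w 2 P) :
    eLpNorm w 2 P ≤ ENNReal.ofReal (L ^ (q / (q - 2))) * eLpNorm w 1 P := by
  rcases eq_or_ne (eLpNorm w 2 P) 0 with h0 | h0
  · exact h0.trans_le zero_le
  have hq₂ : 0 < q - 2 := by linarith
  have hfin := hw.eLpNorm_ne_top
  have hpow : eLpNorm w 2 P ^ (q - 2) * eLpNorm w 2 P ^ q ≤
      (ENNReal.ofReal L ^ q * eLpNorm w 1 P ^ (q - 2)) * eLpNorm w 2 P ^ q := calc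
    _ = eLpNorm w 2 P ^ (2 * (q - 1)) := by rw [← ENNReal.rpow_add _ _ h0 hfin]; ring_nf
    _ ≤ eLpNorm w 1 P ^ (q - 2) * (ENNReal.ofReal L * eLpNorm w 2 P) ^ q :=
      (eLpNorm_two_rpow_le hw.aestronglyMeasurable hq).trans (by gcongr)
    _ = _ := by rw [ENNReal.mul_rpow_of_nonneg _ _ (by linarith)]; ring
  have hcancel := (ENNReal.mul_le_mul_iff_left (ENNReal.rpow_pos (pos_iff_ne_zero.2 h0) hfin).ne'
    (ENNReal.rpow_ne_top_of_nonneg (by linarith) hfin)).1 hpow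
  rw [← ENNReal.rpow_le_rpow_iff hq₂, ENNReal.mul_rpow_of_nonneg _ _ hq₂.le,
    ENNReal.ofReal_rpow_of_nonneg (by positivity) hq₂.le, ← Real.rpow_mul (by linarith),
    div_mul_cancel₀ _ hq₂.ne', ← ENNReal.ofReal_rpow_of_nonneg (by linarith) (by linarith)]
  exact hcancel

lemma l1Ratio_mul_lpNorm_le (hw : MemLp w 2 P) (hwi : MemLp w 1 P) (hq : 2 < q) (hL : 1 ≤ L)
    (h : eLpNorm w (ENNReal.ofReal q) P ≤ ENNReal.ofReal L * eLpNorm w 2 P) :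
    l1Ratio q L * lpNorm w 2 P ≤ ∫ z, |w z| ∂P := by
  have hLq : 0 < L ^ (q / (q - 2)) := by positivity
  have := eLpNorm_two_le_mul_eLpNorm_one hw hq hL h
  rw [← ofReal_lpNorm hw, ← ofReal_lpNorm hwi, ← ENNReal.ofReal_mul hLq.le,
    ENNReal.ofReal_le_ofReal_iff (mul_nonneg hLq.le lpNorm_nonneg),
    lpNorm_one_eq_integral_norm hw.aestronglyMeasurable] at this
  exact (inv_mul_le_iff₀ hLq).2 this

lemma le_mul_sq_add_div {a ρ : ℝ} (ha : 0 < a) (hρ : 0 < ρ) (x : ℝ) :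
    x ≤ a / (4 * ρ) * x ^ 2 + ρ / a := by
  have heq : a / (4 * ρ) * x ^ 2 + ρ / a - x = (a * x - 2 * ρ) ^ 2 / (4 * ρ * a) := by
    field_simp
    ring
  exact sub_nonneg.1 (heq ▸ by positivity)

variable [IsProbabilityMeasure P] {a : ℝ}

/- The Paley–Zygmund argument: below the level `a * ‖w‖₂ / 2` the function contributes at most half
of its `L₁` norm, and above it `le_mul_sq_add_div` plays the role of Cauchy–Schwarz. -/
lemma le_measureReal_abs_gt (hwm : Measurable w) (hw : MemLp w 2 P) (ha : 0 < a)
    (h : a * lpNorm w 2 P ≤ ∫ z, |w z| ∂P) (hw₀ : 0 < lpNorm w 2 P) :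
    a ^ 2 / 4 ≤ P.real {z | a * lpNorm w 2 P / 2 < |w z|} := by
  set ρ := lpNorm w 2 P
  set A := {z | a * ρ / 2 < |w z|}
  let bound : 𝓩 → ℝ := fun z =>
    a * ρ / 2 + (a / (4 * ρ) * w z ^ 2 + ρ / a * A.indicator (fun _ => 1) z)
  have hA : MeasurableSet A := measurableSet_lt measurable_const hwm.abs
  have hsq : Integrable (fun z => a / (4 * ρ) * w z ^ 2) P := hw.integrable_sq.const_mul _
  have hind : Integrable (fun z => ρ / a * A.indicator (fun _ => (1 : ℝ)) z) P :=
    ((integrable_const _).indicator hA).const_mul _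
  have hadd : Integrable (fun z => a / (4 * ρ) * w z ^ 2 +
      ρ / a * A.indicator (fun _ => (1 : ℝ)) z) P := hsq.add hind
  have hpt : ∀ z, |w z| ≤ bound z := by
    intro z
    by_cases hz : z ∈ A
    · simp only [bound, Set.indicator_of_mem hz]
      have := sq_abs (w z) ▸ le_mul_sq_add_div ha hw₀ |w z|
      have : 0 < a * ρ / 2 := by positivity
      linarith
    · simp only [bound, Set.indicator_of_notMem hz]
      have : |w z| ≤ a * ρ / 2 := not_lt.1 hz
      have : 0 ≤ a / (4 * ρ) * w z ^ 2 := by positivity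
      linarith
  have hbound : ∫ z, bound z ∂P = a * ρ / 2 + (a / (4 * ρ) * ρ ^ 2 + ρ / a * P.real A) := by
    simp only [bound]
    rw [integral_add (integrable_const _) hadd, integral_add hsq hind,
      integral_const_mul, integral_const_mul, integral_indicator_const _ hA, ← lpNorm_two_sq hw]
    simp only [integral_const, probReal_univ, smul_eq_mul, one_mul, mul_one, ρ]
  have hint : a * ρ ≤ a * ρ / 2 + (a / (4 * ρ) * ρ ^ 2 + ρ / a * P.real A) :=
    (h.trans (integral_mono (hw.integrable one_le_two).abs
      ((integrable_const _).add hadd) hpt)).trans_eq hbound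
  have hρ : a / (4 * ρ) * ρ ^ 2 = a * ρ / 4 := by field_simp
  have : ρ / a * (a ^ 2 / 4) = a * ρ / 4 := by field_simp
  exact le_of_mul_le_mul_left (a := ρ / a) (by linarith) (by positivity)

lemma tendsto_lpNorm_of_tendsto {v : ℕ → 𝓩 → ℝ} (hvm : ∀ k, Measurable (v k))
    (hv : ∀ k, MemLp (v k) 2 P) (ha : 0 < a) (h : ∀ k, a * lpNorm (v k) 2 P ≤ ∫ z, |v k z| ∂P)
    (hlim : ∀ z, Tendsto (fun k => v k z) atTop (𝓝 0)) :
    Tendsto (fun k => lpNorm (v k) 2 P) atTop (𝓝 0) := by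
  have hmeas : TendstoInMeasure P v atTop fun _ => 0 :=
    tendstoInMeasure_of_tendsto_ae (fun k => (hvm k).aestronglyMeasurable) (.of_forall hlim)
  rw [tendstoInMeasure_iff_measureReal_norm] at hmeas
  refine tendsto_order.2 ⟨fun c hc => .of_forall fun k => hc.trans_le lpNorm_nonneg,
    fun δ hδ => ?_⟩
  filter_upwards [(hmeas (a * δ / 2) (by positivity)).eventually
    (gt_mem_nhds (show 0 < a ^ 2 / 4 by positivity))] with k hk
  by_contra! hδk
  have hsmall := le_measureReal_abs_gt (hvm k) (hv k) ha (h k) (hδ.trans_le hδk)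
  refine hk.not_ge (hsmall.trans (measureReal_mono fun z hz => ?_))
  calc a * δ / 2 ≤ a * lpNorm (v k) 2 P / 2 := by gcongr
    _ ≤ ‖v k z - 0‖ := by simpa only [sub_zero] using le_of_lt hz

end Norms

section ScaleFactor

variable {𝓩 : Type*} [MeasurableSpace 𝓩] {P : Measure 𝓩} {r : ℝ}

/-- The factor that scales `w` down to `L₂` norm at most `r`. -/
noncomputable def scaleFactor (P : Measure 𝓩) (r : ℝ) (w : 𝓩 → ℝ) : ℝ :=
  if lpNorm w 2 P ≤ r then 1 else r / lpNorm w 2 P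

lemma scaleFactor_pos (hr : 0 < r) (w : 𝓩 → ℝ) : 0 < scaleFactor P r w := by
  unfold scaleFactor
  split_ifs with h
  · exact one_pos
  · exact div_pos hr (hr.trans (not_le.1 h))

lemma scaleFactor_le_one (hr : 0 < r) (w : 𝓩 → ℝ) : scaleFactor P r w ≤ 1 := by
  unfold scaleFactor
  split_ifs with h
  · exact le_rfl
  · exact (div_le_one (hr.trans (not_le.1 h))).2 (not_le.1 h).le

lemma scaleFactor_mul_lpNorm (hr : 0 < r) (w : 𝓩 → ℝ) :
    scaleFactor P r w * lpNorm w 2 P = min (lpNorm w 2 P) r := by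
  unfold scaleFactor
  split_ifs with h
  · rw [one_mul, min_eq_left h]
  · rw [div_mul_cancel₀ _ (hr.trans (not_le.1 h)).ne', min_eq_right (not_le.1 h).le]

end ScaleFactor

section Complexity

variable {𝓧 : Type u} {N : ℕ}

lemma sum_piFinset_sign {M : Type*} [AddCommMonoid M] (G : (Fin N → ℝ) → M) :
    ∑ ε ∈ Fintype.piFinset (fun _ : Fin N => ({-1, 1} : Finset ℝ)), G ε =
      ∑ ε : Fin N → ℤˣ, G fun i => (ε i : ℝ) := by
  refine (Finset.sum_nbij' (fun (ε : Fin N → ℤˣ) i => (ε i : ℝ))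
    (fun b i => if b i = 1 then 1 else -1)
    (fun ε _ => ?_) (fun _ _ => Finset.mem_univ _) (fun ε _ => ?_) (fun b hb => ?_)
    fun _ _ => rfl).symm
  · refine Fintype.mem_piFinset.2 fun i => ?_
    rcases Int.units_eq_one_or (ε i) with h | h <;> simp [h]
  · ext i
    rcases Int.units_eq_one_or (ε i) with h | h <;> norm_num [h]
  · ext i
    have := Fintype.mem_piFinset.1 hb i
    rcases (by simpa using this : b i = -1 ∨ b i = 1) with h | h <;> norm_num [h]

lemma smul_mem_starZero {A : Set (𝓧 → ℝ)} {u : 𝓧 → ℝ} (hu : u ∈ starZero A) {c : ℝ}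
    (hc : 0 ≤ c) (hc1 : c ≤ 1) : c • u ∈ starZero A := by
  obtain ⟨a, ha, t, ht, ht1, rfl⟩ := hu
  exact ⟨a, ha, c * t, mul_nonneg hc ht, mul_le_one₀ hc1 ht ht1, smul_smul c t a⟩

variable [MeasurableSpace 𝓧] {F : Set (𝓧 → ℝ)} {h : 𝓧 → ℝ} {r ρ : ℝ}

lemma smul_mem_localization {u : 𝓧 → ℝ} {μ : Measure 𝓧} (hρ : 0 < ρ) (hr : ρ ≤ r)
    (hu : u ∈ localization μ F h r) : (ρ / r) • u ∈ localization μ F h ρ := by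
  have hr₀ : 0 < r := hρ.trans_le hr
  refine ⟨smul_mem_starZero hu.1 (by positivity) ((div_le_one hr₀).2 hr), ?_⟩
  calc eLpNorm ((ρ / r) • u) 2 μ = ENNReal.ofReal (ρ / r) * eLpNorm u 2 μ := by
        rw [eLpNorm_const_smul, Real.enorm_eq_ofReal (by positivity)]
    _ ≤ ENNReal.ofReal (ρ / r) * ENNReal.ofReal r := by gcongr; exact hu.2
    _ = ENNReal.ofReal ρ := by
        rw [← ENNReal.ofReal_mul (by positivity), div_mul_cancel₀ _ hr₀.ne']

variable {K : Type*} [Finite K] [Nonempty K] {P : Measure (𝓧 × ℝ)} [IsProbabilityMeasure P]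
  {A : Set (𝓧 → ℝ)} {ξ : 𝓧 × ℝ → ℝ} {u : K → 𝓧 → ℝ} {B κ : ℝ}

lemma ofReal_integral_iSup_le_lintegral (hu : ∀ k, u k ∈ A)
    (hi : ∀ k, Integrable (fun z => ξ z * u k z.1) P) (a : Fin N → ℝ) :
    ENNReal.ofReal ((√(N : ℝ))⁻¹ * ∫ D : Fin N → 𝓧 × ℝ, ⨆ k, |∑ i, a i * (ξ (D i) * u k (D i).1)|
        ∂(Measure.pi fun _ => P)) ≤
      ∫⁻ D, ⨆ v ∈ A, ENNReal.ofReal |(√(N : ℝ))⁻¹ * ∑ i, a i * (ξ (D i) * v (D i).1)|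
        ∂(Measure.pi fun _ : Fin N => P) := by
  have hint : Integrable (fun D : Fin N → 𝓧 × ℝ => ⨆ k, |∑ i, a i * (ξ (D i) * u k (D i).1)|)
      (Measure.pi fun _ => P) :=
    integrable_ciSup_of_finite fun k => (integrable_sum_mul_eval hi a k).abs
  rw [← integral_const_mul, ofReal_integral_eq_lintegral_ofReal (hint.const_mul _)
    (.of_forall fun D => mul_nonneg (by positivity) (Real.iSup_nonneg fun k => abs_nonneg _))]
  refine lintegral_mono fun D => ?_
  obtain ⟨k, hk⟩ := exists_eq_ciSup_of_finite
    (f := fun k => |∑ i, a i * (ξ (D i) * u k (D i).1)|)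
  rw [← hk, ← abs_of_nonneg (by positivity : (0 : ℝ) ≤ (√(N : ℝ))⁻¹), ← abs_mul,
    abs_of_nonneg (by positivity : (0 : ℝ) ≤ (√(N : ℝ))⁻¹)]
  exact le_iSup₂ (f := fun (v : 𝓧 → ℝ) (_ : v ∈ A) =>
    ENNReal.ofReal |(√(N : ℝ))⁻¹ * ∑ i, a i * (ξ (D i) * v (D i).1)|) (u k) (hu k)

lemma ofReal_expect_sign {f : (Fin N → ℤˣ) → ℝ} (hf : ∀ ε, 0 ≤ f ε) :
    ENNReal.ofReal (𝔼 ε, f ε) = (2 ^ N)⁻¹ * ∑ ε, ENNReal.ofReal (f ε) := by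
  rw [Fintype.expect_eq_sum_div_card, div_eq_inv_mul, ENNReal.ofReal_mul (by positivity),
    ENNReal.ofReal_sum_of_nonneg fun ε _ => hf ε, ENNReal.ofReal_inv_of_pos (by positivity)]
  simp

lemma expect_integral_iSup_le_of_rademacherSup_le (hu : ∀ k, u k ∈ A)
    (hi : ∀ k, Integrable (fun z => ξ z * u k z.1) P) (hB : 0 ≤ B)
    (h : rademacherSup P N A ξ ≤ ENNReal.ofReal B) :
    (√(N : ℝ))⁻¹ * 𝔼 ε : Fin N → ℤˣ, ∫ D : Fin N → 𝓧 × ℝ,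
      ⨆ k, |∑ i, (ε i : ℝ) * (ξ (D i) * u k (D i).1)| ∂(Measure.pi fun _ => P) ≤ B := by
  rw [← ENNReal.ofReal_le_ofReal_iff hB, Finset.mul_expect]
  refine le_trans ?_ h
  rw [ofReal_expect_sign fun ε => mul_nonneg (by positivity)
    (integral_nonneg fun D => Real.iSup_nonneg fun k => abs_nonneg _), rademacherSup,
    sum_piFinset_sign]
  gcongr
  exact ofReal_integral_iSup_le_lintegral hu hi _

lemma expect_integral_iSup_le_of_rademacherSup_localization_le (hρ : 0 < ρ) (hr : ρ ≤ r)
    (hu : ∀ k, u k ∈ localization (P.map Prod.fst) F h r)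
    (hi : ∀ k, Integrable (fun z => ξ z * u k z.1) P) (hB : 0 ≤ B)
    (hle : rademacherSup P N (localization (P.map Prod.fst) F h ρ) ξ ≤
      ENNReal.ofReal (B * √N * ρ)) :
    𝔼 ε : Fin N → ℤˣ, ∫ D : Fin N → 𝓧 × ℝ,
      ⨆ k, |∑ i, (ε i : ℝ) * (ξ (D i) * u k (D i).1)| ∂(Measure.pi fun _ => P) ≤ B * N * r := by
  rcases N.eq_zero_or_pos with rfl | hN
  · simp
  have hr₀ : 0 < r := hρ.trans_le hr
  have hscale (a : Fin N → ℝ) (D : Fin N → 𝓧 × ℝ) :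
      ⨆ k, |∑ i, a i * (ξ (D i) * ((ρ / r) • u k) (D i).1)| =
        ρ / r * ⨆ k, |∑ i, a i * (ξ (D i) * u k (D i).1)| := by
    rw [Real.mul_iSup_of_nonneg (by positivity)]
    refine iSup_congr fun k => ?_
    rw [← abs_of_nonneg (by positivity : 0 ≤ ρ / r), ← abs_mul, Finset.mul_sum,
      abs_of_nonneg (by positivity : 0 ≤ ρ / r)]
    refine congrArg _ (Finset.sum_congr rfl fun i _ => ?_)
    rw [Pi.smul_apply, smul_eq_mul]
    ring
  have hi' (k : K) : Integrable (fun z => ξ z * ((ρ / r) • u k) z.1) P := by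
    refine ((hi k).const_mul (ρ / r)).congr (.of_forall fun z => ?_)
    simp only [Pi.smul_apply, smul_eq_mul]
    ring
  have hbound := expect_integral_iSup_le_of_rademacherSup_le
    (fun k => smul_mem_localization hρ hr (hu k)) hi' (by positivity) hle
  simp only [hscale, integral_const_mul, ← Finset.mul_expect] at hbound
  have hsqrt : 0 < √(N : ℝ) := Real.sqrt_pos.2 (by exact_mod_cast hN)
  rw [inv_mul_le_iff₀ hsqrt, div_mul_eq_mul_div, div_le_iff₀ hr₀] at hbound
  refine le_of_mul_le_mul_left (hbound.trans_eq ?_) hρ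
  calc √(N : ℝ) * (B * √N * ρ) * r = ρ * (B * (√(N : ℝ) * √N) * r) := by ring
    _ = ρ * (B * N * r) := by rw [Real.mul_self_sqrt N.cast_nonneg]

lemma expect_integral_iSup_le_of_rE_lt (hκ : 0 ≤ κ) (hr : rE P N F h κ < ENNReal.ofReal r)
    (hu : ∀ k, u k ∈ localization (P.map Prod.fst) F h r)
    (hi : ∀ k, Integrable (fun z : 𝓧 × ℝ => u k z.1) P) :
    𝔼 ε : Fin N → ℤˣ, ∫ D : Fin N → 𝓧 × ℝ,
      ⨆ k, |∑ i, (ε i : ℝ) * u k (D i).1| ∂(Measure.pi fun _ => P) ≤ κ * N * r := by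
  simp only [rE, iInf_lt_iff] at hr
  obtain ⟨ρ, hρ, hle, hlt⟩ := hr
  have hρr : ρ < r := (ENNReal.ofReal_lt_ofReal_iff'.1 hlt).1
  simpa only [one_mul] using expect_integral_iSup_le_of_rademacherSup_localization_le
    (ξ := fun _ => 1) hρ hρr.le hu (by simpa only [one_mul] using hi) hκ hle

lemma expect_integral_iSup_le_of_rM_lt (hκ : 0 ≤ κ) (hr : rM P N F h κ < ENNReal.ofReal r)
    (hu : ∀ k, u k ∈ localization (P.map Prod.fst) F h r)
    (hi : ∀ k, Integrable (fun z : 𝓧 × ℝ => (h z.1 - z.2) * u k z.1) P) :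
    𝔼 ε : Fin N → ℤˣ, ∫ D : Fin N → 𝓧 × ℝ,
      ⨆ k, |∑ i, (ε i : ℝ) * ((h (D i).1 - (D i).2) * u k (D i).1)| ∂(Measure.pi fun _ => P) ≤
      κ * N * r ^ 2 := by
  simp only [rM, iInf_lt_iff] at hr
  obtain ⟨ρ, hρ, hle, hlt⟩ := hr
  have hρr : ρ < r := (ENNReal.ofReal_lt_ofReal_iff'.1 hlt).1
  have hr₀ : 0 < r := hρ.trans hρr
  calc _ ≤ κ * ρ * N * r := expect_integral_iSup_le_of_rademacherSup_localization_le hρ hρr.le hu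
        hi (by positivity) (hle.trans_eq (by ring_nf))
    _ ≤ κ * r * N * r := by gcongr
    _ = κ * N * r ^ 2 := by ring

end Complexity

section BlockMeans

open Filter Topology

variable {N : ℕ}

lemma blockMean_const_mul (m : ℕ) (c : ℝ) (v : Fin N → ℝ) (j : ℕ) :
    blockMean m (fun i => c * v i) j = c * blockMean m v j := by
  simp only [blockMean, ← Finset.mul_sum, mul_left_comm]

lemma blockMean_add (m : ℕ) (v v' : Fin N → ℝ) (j : ℕ) :
    blockMean m (fun i => v i + v' i) j = blockMean m v j + blockMean m v' j := by
  simp only [blockMean, Finset.sum_add_distrib, mul_add]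

lemma tendsto_blockMean {v : ℕ → Fin N → ℝ} {v₀ : Fin N → ℝ} (m j : ℕ)
    (h : ∀ i, Tendsto (fun k => v k i) atTop (𝓝 (v₀ i))) :
    Tendsto (fun k => blockMean m (v k) j) atTop (𝓝 (blockMean m v₀ j)) :=
  (tendsto_finsetSum _ fun i _ => h i).const_mul _

lemma sq_blockMean_le {n m : ℕ} (h : n * m ≤ N) (v : Fin N → ℝ) (j : Fin n) :
    blockMean m v j ^ 2 ≤ blockMean m (fun i => v i ^ 2) j := by
  rw [blockMean_eq h, blockMean_eq h, inv_mul_eq_div, inv_mul_eq_div]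
  simpa [toBlocks] using sum_div_card_sq_le_sum_sq_div_card (s := Finset.univ) (f := toBlocks h v j)

end BlockMeans

section TournamentSetup

open Filter Topology

variable {𝓧 : Type u} {F : Set (𝓧 → ℝ)}

/-- The sequence `gs` enumerates a subset of `F` whose pointwise sequential limits exhaust `F`. -/
structure IsPointwiseDenseSeq (F : Set (𝓧 → ℝ)) (gs : ℕ → 𝓧 → ℝ) : Prop where
  mem : ∀ k, gs k ∈ F
  exists_tendsto : ∀ f ∈ F, ∃ φ : ℕ → ℕ, ∀ x, Tendsto (fun k => gs (φ k) x) atTop (𝓝 (f x))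

lemma IsPointwiseMeasurableClass.exists_isPointwiseDenseSeq (hF : IsPointwiseMeasurableClass F)
    (hne : F.Nonempty) : ∃ gs, IsPointwiseDenseSeq F gs := by
  obtain ⟨G, hGF, hG, hlim⟩ := hF
  obtain ⟨f, hf⟩ := hne
  obtain ⟨g, hgG, -⟩ := hlim f hf
  obtain ⟨gs, rfl⟩ := hG.exists_eq_range ⟨g 0, hgG 0⟩
  refine ⟨gs, fun k => hGF ⟨k, rfl⟩, fun f hf => ?_⟩
  obtain ⟨g, hg, hgf⟩ := hlim f hf
  choose φ hφ using hg
  exact ⟨φ, fun x => by simpa only [hφ] using hgf x⟩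

variable [MeasurableSpace 𝓧] {P : Measure (𝓧 × ℝ)}

lemma memLp_sub_comp_fst {f h : 𝓧 → ℝ} {p : ℝ≥0∞} (hf : MemLp f p (P.map Prod.fst))
    (hh : MemLp h p (P.map Prod.fst)) : MemLp (fun z : 𝓧 × ℝ => f z.1 - h z.1) p P :=
  (hf.sub hh).comp_measurePreserving (measurable_fst.measurePreserving P)

lemma eLpNorm_sub_comp_fst {f h : 𝓧 → ℝ} (hf : AEStronglyMeasurable f (P.map Prod.fst))
    (hh : AEStronglyMeasurable h (P.map Prod.fst)) (p : ℝ≥0∞) :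
    eLpNorm (fun z : 𝓧 × ℝ => f z.1 - h z.1) p P = eLpNorm (f - h) p (P.map Prod.fst) :=
  (eLpNorm_map_measure (hf.sub hh) measurable_fst.aemeasurable).symm

/-- What the analysis of the tournament uses of the class: the `L₁` and `L₂` norms of differences
are comparable, and the products of the noise with `f - fs` have a nonnegative mean and a
controlled second moment. -/
structure TournamentSetup (a S σ : ℝ) (P : Measure (𝓧 × ℝ)) (F : Set (𝓧 → ℝ)) (fs : 𝓧 → ℝ) :
    Prop where
  measurable : ∀ f ∈ F, Measurable f
  pointwiseMeasurable : IsPointwiseMeasurableClass F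
  memLp : ∀ f ∈ F, MemLp f 2 (P.map Prod.fst)
  mem : fs ∈ F
  mul_lpNorm_le_integral_abs : ∀ f ∈ F, ∀ h ∈ F,
    a * lpNorm (fun z => f z.1 - h z.1) 2 P ≤ ∫ z, |f z.1 - h z.1| ∂P
  memLp_mul : ∀ f ∈ F, MemLp (fun z => (fs z.1 - z.2) * (f z.1 - fs z.1)) 2 P
  lpNorm_mul_le : ∀ f ∈ F, lpNorm (fun z => (fs z.1 - z.2) * (f z.1 - fs z.1)) 2 P ≤
    S * σ * lpNorm (fun z => f z.1 - fs z.1) 2 P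
  integral_mul_nonneg : ∀ f ∈ F, 0 ≤ ∫ z, (fs z.1 - z.2) * (f z.1 - fs z.1) ∂P

/-- The function `g - fs`, scaled down to norm at most `r`. -/
noncomputable def scaledDiff (P : Measure (𝓧 × ℝ)) (r : ℝ) (fs g : 𝓧 → ℝ) : 𝓧 → ℝ :=
  fun x => scaleFactor P r (fun z => g z.1 - fs z.1) * (g x - fs x)

variable {r : ℝ} {fs g : 𝓧 → ℝ}

lemma lpNorm_scaledDiff (hr : 0 < r) (fs g : 𝓧 → ℝ) :
    lpNorm (fun z => scaledDiff P r fs g z.1) 2 P =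
      min (lpNorm (fun z => g z.1 - fs z.1) 2 P) r := by
  rw [← scaleFactor_mul_lpNorm hr]
  exact lpNorm_const_mul_of_nonneg (scaleFactor_pos hr _).le _ _

lemma mul_scaledDiff (fs g : 𝓧 → ℝ) : (fun z : 𝓧 × ℝ => (fs z.1 - z.2) * scaledDiff P r fs g z.1) =
    fun z => scaleFactor P r (fun z => g z.1 - fs z.1) *
      ((fs z.1 - z.2) * (g z.1 - fs z.1)) :=
  funext fun _ => mul_left_comm _ _ _

namespace TournamentSetup

variable {a S σ : ℝ} (H : TournamentSetup a S σ P F fs)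
include H

lemma memLp_sub {f h : 𝓧 → ℝ} (hf : f ∈ F) (hh : h ∈ F) :
    MemLp (fun z : 𝓧 × ℝ => f z.1 - h z.1) 2 P :=
  memLp_sub_comp_fst (H.memLp f hf) (H.memLp h hh)

lemma measurable_sub {f h : 𝓧 → ℝ} (hf : f ∈ F) (hh : h ∈ F) :
    Measurable (fun z : 𝓧 × ℝ => f z.1 - h z.1) :=
  ((H.measurable f hf).comp measurable_fst).sub ((H.measurable h hh).comp measurable_fst)

lemma eLpNorm_sub {f h : 𝓧 → ℝ} (hf : f ∈ F) (hh : h ∈ F) :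
    eLpNorm (f - h) 2 (P.map Prod.fst) =
      ENNReal.ofReal (lpNorm (fun z => f z.1 - h z.1) 2 P) := by
  rw [ofReal_lpNorm (H.memLp_sub hf hh), eLpNorm_sub_comp_fst (H.memLp f hf).aestronglyMeasurable
    (H.memLp h hh).aestronglyMeasurable]

lemma scaledDiff_mem_localization (hr : 0 < r) (hg : g ∈ F) :
    scaledDiff P r fs g ∈ localization (P.map Prod.fst) F fs r := by
  have hs : scaledDiff P r fs g = scaleFactor P r (fun z => g z.1 - fs z.1) • (g - fs) := rfl
  refine ⟨⟨g - fs, ⟨g, hg, rfl⟩, _, (scaleFactor_pos hr _).le, scaleFactor_le_one hr _, hs⟩, ?_⟩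
  rw [hs, eLpNorm_const_smul, Real.enorm_eq_ofReal (scaleFactor_pos hr _).le,
    H.eLpNorm_sub hg H.mem, ← ENNReal.ofReal_mul (scaleFactor_pos hr _).le,
    scaleFactor_mul_lpNorm hr]
  exact ENNReal.ofReal_le_ofReal (min_le_right _ _)

lemma memLp_scaledDiff (hg : g ∈ F) : MemLp (fun z : 𝓧 × ℝ => scaledDiff P r fs g z.1) 2 P :=
  (H.memLp_sub hg H.mem).const_mul _

lemma measurable_scaledDiff (hg : g ∈ F) :
    Measurable (fun z : 𝓧 × ℝ => scaledDiff P r fs g z.1) :=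
  (H.measurable_sub hg H.mem).const_mul _

lemma mul_min_le_integral_abs_scaledDiff (hr : 0 < r) (hg : g ∈ F) :
    a * min (lpNorm (fun z => g z.1 - fs z.1) 2 P) r ≤ ∫ z, |scaledDiff P r fs g z.1| ∂P := by
  simp only [scaledDiff, abs_mul]
  rw [integral_const_mul, abs_of_pos (scaleFactor_pos hr _), ← scaleFactor_mul_lpNorm hr,
    mul_left_comm]
  exact mul_le_mul_of_nonneg_left (H.mul_lpNorm_le_integral_abs g hg fs H.mem)
    (scaleFactor_pos hr _).le

lemma integral_abs_scaledDiff_le [IsProbabilityMeasure P] (hr : 0 < r) (hg : g ∈ F) :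
    ∫ z, |scaledDiff P r fs g z.1| ∂P ≤ r :=
  (integral_abs_le_lpNorm_two (H.memLp_scaledDiff hg)).trans
    ((lpNorm_scaledDiff hr fs g).trans_le (min_le_right _ _))

lemma integral_sq_scaledDiff_le (hr : 0 < r) (hg : g ∈ F) :
    ∫ z, scaledDiff P r fs g z.1 ^ 2 ∂P ≤ r ^ 2 := by
  rw [← lpNorm_two_sq (H.memLp_scaledDiff hg), lpNorm_scaledDiff hr]
  exact pow_le_pow_left₀ (le_min lpNorm_nonneg hr.le) (min_le_right _ _) 2

lemma memLp_mul_scaledDiff (hg : g ∈ F) :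
    MemLp (fun z : 𝓧 × ℝ => (fs z.1 - z.2) * scaledDiff P r fs g z.1) 2 P := by
  rw [mul_scaledDiff]; exact (H.memLp_mul g hg).const_mul _

lemma measurable_mul_scaledDiff (hg : g ∈ F) :
    Measurable (fun z : 𝓧 × ℝ => (fs z.1 - z.2) * scaledDiff P r fs g z.1) :=
  (((H.measurable fs H.mem).comp measurable_fst).sub measurable_snd).mul
    (H.measurable_scaledDiff hg)

lemma integral_mul_scaledDiff_nonneg (hr : 0 < r) (hg : g ∈ F) :
    0 ≤ ∫ z, (fs z.1 - z.2) * scaledDiff P r fs g z.1 ∂P := by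
  rw [mul_scaledDiff, integral_const_mul]
  exact mul_nonneg (scaleFactor_pos hr _).le (H.integral_mul_nonneg g hg)

lemma integral_sq_mul_scaledDiff_le (hr : 0 < r) (hS : 0 ≤ S) (hσ : 0 ≤ σ) (hg : g ∈ F) :
    ∫ z, ((fs z.1 - z.2) * scaledDiff P r fs g z.1) ^ 2 ∂P ≤ (S * σ * r) ^ 2 := by
  rw [← lpNorm_two_sq (H.memLp_mul_scaledDiff hg)]
  refine pow_le_pow_left₀ lpNorm_nonneg ?_ 2
  have ht := (scaleFactor_pos (P := P) hr fun z => g z.1 - fs z.1).le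
  calc lpNorm (fun z => (fs z.1 - z.2) * scaledDiff P r fs g z.1) 2 P
      = scaleFactor P r (fun z => g z.1 - fs z.1) *
          lpNorm (fun z => (fs z.1 - z.2) * (g z.1 - fs z.1)) 2 P := by
        rw [mul_scaledDiff, lpNorm_const_mul_of_nonneg ht]
    _ ≤ scaleFactor P r (fun z => g z.1 - fs z.1) *
          (S * σ * lpNorm (fun z => g z.1 - fs z.1) 2 P) := by
        gcongr; exact H.lpNorm_mul_le g hg
    _ = S * σ * min (lpNorm (fun z => g z.1 - fs z.1) 2 P) r := by
        rw [mul_left_comm, scaleFactor_mul_lpNorm hr]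
    _ ≤ S * σ * r := by gcongr; exact min_le_right _ _

lemma exists_tendsto_lpNorm_sub [IsProbabilityMeasure P] (ha : 0 < a) {gs : ℕ → 𝓧 → ℝ}
    (hgs : IsPointwiseDenseSeq F gs) {f : 𝓧 → ℝ} (hf : f ∈ F) :
    ∃ φ : ℕ → ℕ, (∀ x, Tendsto (fun k => gs (φ k) x) atTop (𝓝 (f x))) ∧
      Tendsto (fun k => lpNorm (fun z => gs (φ k) z.1 - fs z.1) 2 P) atTop
        (𝓝 (lpNorm (fun z => f z.1 - fs z.1) 2 P)) := by
  obtain ⟨φ, hφ⟩ := hgs.exists_tendsto f hf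
  refine ⟨φ, hφ, ?_⟩
  have hdist : Tendsto (fun k => lpNorm (fun z => gs (φ k) z.1 - f z.1) 2 P) atTop (𝓝 0) :=
    tendsto_lpNorm_of_tendsto (fun k => H.measurable_sub (hgs.mem _) hf)
      (fun k => H.memLp_sub (hgs.mem _) hf) ha
      (fun k => H.mul_lpNorm_le_integral_abs _ (hgs.mem _) _ hf) fun z => by
        simpa using (hφ z.1).sub_const (f z.1)
  rw [tendsto_iff_dist_tendsto_zero]
  refine squeeze_zero (fun _ => dist_nonneg) (fun k => ?_) hdist
  have hsub : (fun z : 𝓧 × ℝ => gs (φ k) z.1 - f z.1) =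
      (fun z => gs (φ k) z.1 - fs z.1) - fun z => f z.1 - fs z.1 := by
    ext z; simp
  rw [Real.dist_eq, abs_sub_le_iff, hsub, sub_le_iff_le_add', sub_le_iff_le_add']
  exact ⟨lpNorm_le_lpNorm_add_lpNorm_sub' (H.memLp_sub hf H.mem) one_le_two,
    lpNorm_le_lpNorm_add_lpNorm_sub (H.memLp_sub (hgs.mem _) H.mem) one_le_two⟩

variable [IsProbabilityMeasure P] {N n m : ℕ} {c₁ γ : ℝ} {gs : ℕ → 𝓧 → ℝ}

lemma measure_exists_deviatingBlocks_abs_le (h : n * m ≤ N) (h₂ : N ≤ 2 * (n * m)) (hm : 0 < m)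
    (hr : 0 < r) (hc₁ : 0 ≤ c₁) (hγ : 0 < γ) (hrE : rE P N F fs c₁ < ENNReal.ofReal r)
    (hgs : ∀ k, gs k ∈ F) (hsb : r / √m + 8 * c₁ * r ≤ γ / 20) :
    (Measure.pi fun _ => P) {D : Fin N → 𝓧 × ℝ | ∃ k, (n : ℝ) / 10 ≤
      deviatingBlocks P n m (fun z => |scaledDiff P r fs (gs k) z.1|) γ D} ≤
      ENNReal.ofReal (Real.exp (-(n / 200))) := by
  have hi (k : ℕ) : Integrable (fun z : 𝓧 × ℝ => scaledDiff P r fs (gs k) z.1) P :=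
    (H.memLp_scaledDiff (hgs k)).integrable one_le_two
  refine measure_exists_deviatingBlocks_ge_le h hm
    (fun k => (H.measurable_scaledDiff (hgs k)).abs) (fun k => (H.memLp_scaledDiff (hgs k)).abs)
    hr.le hγ (b := 2 * c₁ * r) (fun k => ?_) (fun M => ?_) (by linarith)
  · simpa only [sq_abs] using H.integral_sq_scaledDiff_le hr (hgs k)
  · have hN : (N : ℝ) ≤ 2 * (n * m) := by exact_mod_cast h₂
    calc rademacherAvg (Fin n × Fin m) P
          (fun (k : Fin (M + 1)) z => |scaledDiff P r fs (gs k) z.1|)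
        ≤ rademacherAvg (Fin n × Fin m) P
          (fun (k : Fin (M + 1)) z => scaledDiff P r fs (gs k) z.1) :=
          rademacherAvg_abs_le fun k => hi k
      _ ≤ c₁ * N * r :=
          (rademacherAvg_le_of_injective
            ((Fin.castLE_injective h).comp finProdFinEquiv.injective)
            fun k : Fin (M + 1) => hi k).trans
          (expect_integral_iSup_le_of_rE_lt hc₁ hrE
            (fun k : Fin (M + 1) => H.scaledDiff_mem_localization hr (hgs k)) fun k => hi k)
      _ ≤ c₁ * (2 * (n * m)) * r := by gcongr
      _ = n * m * (2 * c₁ * r) := by ring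

lemma measure_exists_deviatingBlocks_mul_le (h : n * m ≤ N) (h₂ : N ≤ 2 * (n * m)) (hm : 0 < m)
    (hr : 0 < r) (hc₁ : 0 ≤ c₁) (hγ : 0 < γ) (hS : 0 ≤ S) (hσ : 0 ≤ σ)
    (hrM : rM P N F fs c₁ < ENNReal.ofReal r) (hgs : ∀ k, gs k ∈ F)
    (hsb : S * σ * r / √m + 8 * c₁ * r ^ 2 ≤ γ / 20) :
    (Measure.pi fun _ => P) {D : Fin N → 𝓧 × ℝ | ∃ k, (n : ℝ) / 10 ≤
      deviatingBlocks P n m (fun z => (fs z.1 - z.2) * scaledDiff P r fs (gs k) z.1) γ D} ≤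
      ENNReal.ofReal (Real.exp (-(n / 200))) := by
  have hi (k : ℕ) : Integrable (fun z : 𝓧 × ℝ => (fs z.1 - z.2) * scaledDiff P r fs (gs k) z.1) P :=
    (H.memLp_mul_scaledDiff (hgs k)).integrable one_le_two
  refine measure_exists_deviatingBlocks_ge_le h hm
    (fun k => H.measurable_mul_scaledDiff (hgs k)) (fun k => H.memLp_mul_scaledDiff (hgs k))
    (s := S * σ * r) (by positivity) hγ (b := 2 * c₁ * r ^ 2)
    (fun k => H.integral_sq_mul_scaledDiff_le hr hS hσ (hgs k)) (fun M => ?_) (by linarith)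
  have hN : (N : ℝ) ≤ 2 * (n * m) := by exact_mod_cast h₂
  calc rademacherAvg (Fin n × Fin m) P
        (fun (k : Fin (M + 1)) z => (fs z.1 - z.2) * scaledDiff P r fs (gs k) z.1)
      ≤ c₁ * N * r ^ 2 :=
        (rademacherAvg_le_of_injective
          ((Fin.castLE_injective h).comp finProdFinEquiv.injective)
          fun k : Fin (M + 1) => hi k).trans
        (expect_integral_iSup_le_of_rM_lt hc₁ hrM
          (fun k : Fin (M + 1) => H.scaledDiff_mem_localization hr (hgs k)) fun k => hi k)
    _ ≤ c₁ * (2 * (n * m)) * r ^ 2 := by gcongr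
    _ = n * m * (2 * c₁ * r ^ 2) := by ring

end TournamentSetup

end TournamentSetup

section Tournament

open Filter Topology
open scoped Finset

variable {𝓧 : Type u} {N ℓ n : ℕ}

lemma distFunctional_comm (ℓ : ℕ) (D : Fin N → 𝓧 × ℝ) (f h : 𝓧 → ℝ) :
    distFunctional ℓ D f h = distFunctional ℓ D h f := by
  simp only [distFunctional, abs_sub_comm]

lemma blockLossDiff_neg (n : ℕ) (D : Fin N → 𝓧 × ℝ) (f h : 𝓧 → ℝ) (j : ℕ) :
    -blockLossDiff n D f h j = blockLossDiff n D h f j := by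
  rw [blockLossDiff, blockLossDiff, neg_eq_neg_one_mul, ← blockMean_const_mul]
  congr 1
  ext i
  ring

lemma Defeats.not_symm {β r : ℝ} {D₁ D₂ : Fin N → 𝓧 × ℝ} {f h : 𝓧 → ℝ}
    (hfh : Defeats ℓ n β r D₁ D₂ f h) : ¬ Defeats ℓ n β r D₁ D₂ h f := by
  rintro ⟨-, hhf⟩
  have hdisj : Disjoint ({j : Fin n | blockLossDiff n D₂ f h j < 0} : Finset (Fin n))
      ({j : Fin n | blockLossDiff n D₂ h f j < 0} : Finset (Fin n)) :=
    Finset.disjoint_filter.2 fun j _ hj => by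
      rw [← blockLossDiff_neg, neg_lt_zero]
      exact hj.not_gt
  have hcard := Finset.card_le_univ (Finset.disjUnion _ _ hdisj)
  rw [Finset.card_disjUnion, Fintype.card_fin] at hcard
  have := hfh.2
  lia

variable [MeasurableSpace 𝓧] {P : Measure (𝓧 × ℝ)} {F : Set (𝓧 → ℝ)} {r : ℝ}

lemma blockMean_abs_scaledDiff (hr : 0 < r) (fs g : 𝓧 → ℝ) (D : Fin N → 𝓧 × ℝ) (m j : ℕ) :
    blockMean m (fun i => |scaledDiff P r fs g (D i).1|) j =
      scaleFactor P r (fun z => g z.1 - fs z.1) *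
        blockMean m (fun i => |fs (D i).1 - g (D i).1|) j := by
  simp only [← blockMean_const_mul, scaledDiff, abs_mul, abs_of_pos (scaleFactor_pos hr _),
    abs_sub_comm]

lemma sq_scaleFactor_mul_blockLossDiff (fs g : 𝓧 → ℝ) (D : Fin N → 𝓧 × ℝ) (n j : ℕ) :
    scaleFactor P r (fun z => g z.1 - fs z.1) ^ 2 * blockLossDiff n D fs g j =
      -(blockMean (N / n) (fun i => |scaledDiff P r fs g (D i).1| ^ 2) j +
        2 * scaleFactor P r (fun z => g z.1 - fs z.1) *
        blockMean (N / n) (fun i => (fs (D i).1 - (D i).2) * scaledDiff P r fs g (D i).1) j) := by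
  rw [blockLossDiff, ← blockMean_const_mul, ← blockMean_const_mul, ← blockMean_add,
    neg_eq_neg_one_mul, ← blockMean_const_mul]
  congr 1
  ext i
  rw [sq_abs, scaledDiff]
  ring

namespace TournamentSetup

variable {a S σ : ℝ} {fs g : 𝓧 → ℝ} (H : TournamentSetup a S σ P F fs)
include H

section Deviations

variable {D : Fin N → 𝓧 × ℝ}

lemma card_lt_blockMean_le_deviatingBlocks [IsProbabilityMeasure P] {k : ℕ} (ha₁ : a ≤ 1)
    (hr : 0 < r) (hg : g ∈ F) (hgr : lpNorm (fun z => g z.1 - fs z.1) 2 P ≤ r) :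
    #{j : Fin k | 5 / 4 * r < blockMean ℓ (fun i => |fs (D i).1 - g (D i).1|) j} ≤
      deviatingBlocks P k ℓ (fun z => |scaledDiff P r fs g z.1|) (a * r / 4) D := by
  refine Finset.card_le_card (Finset.monotone_filter_right _ fun j _ hj => ?_)
  have hmean := H.integral_abs_scaledDiff_le hr hg
  have hscale := blockMean_abs_scaledDiff (P := P) hr fs g D ℓ j
  rw [scaleFactor, if_pos hgr, one_mul] at hscale
  rw [hscale]
  refine lt_of_lt_of_le ?_ (le_abs_self _)
  nlinarith

lemma card_blockMean_lt_le_deviatingBlocks {k : ℕ} (ha : 0 < a) (ha₁ : a ≤ 1) (hr : 0 < r)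
    (hg : g ∈ F) (hgr : 4 / a * r ≤ lpNorm (fun z => g z.1 - fs z.1) 2 P) :
    #{j : Fin k | blockMean ℓ (fun i => |fs (D i).1 - g (D i).1|) j < 3 * r} ≤
      deviatingBlocks P k ℓ (fun z => |scaledDiff P r fs g z.1|) (a * r / 4) D := by
  refine Finset.card_le_card (Finset.monotone_filter_right _ fun j _ hj => ?_)
  have hr_le : r ≤ lpNorm (fun z => g z.1 - fs z.1) 2 P := by
    refine le_trans (le_mul_of_one_le_left hr.le ?_) hgr
    rw [one_le_div₀ ha]
    linarith
  have hmean := H.mul_min_le_integral_abs_scaledDiff hr hg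
  have hscale := scaleFactor_mul_lpNorm (P := P) hr fun z => g z.1 - fs z.1
  rw [min_eq_right hr_le] at hmean hscale
  have ht := scaleFactor_pos (P := P) hr fun z => g z.1 - fs z.1
  rw [blockMean_abs_scaledDiff hr]
  set t := scaleFactor P r fun z => g z.1 - fs z.1
  have hta : t * 4 ≤ a := by
    have : t * (4 / a * r) ≤ r := (mul_le_mul_of_nonneg_left hgr ht.le).trans_eq hscale
    rw [← mul_assoc, mul_le_iff_le_one_left hr, mul_div_assoc', div_le_one ha] at this
    exact this
  have := mul_lt_mul_of_pos_left hj ht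
  refine lt_of_lt_of_le ?_ (neg_le_abs _)
  nlinarith

/- The quadratic part of the scaled loss difference is at least `a² r² / 16` and the multiplier part
at least `-a² r² / 32`. -/
lemma blockLossDiff_le {j : Fin n} (ha : 0 < a) (hr : 0 < r) (hg : g ∈ F)
    (hgr : r / 2 ≤ lpNorm (fun z => g z.1 - fs z.1) 2 P)
    (habs : |blockMean (N / n) (fun i => |scaledDiff P r fs g (D i).1|) j -
      ∫ z, |scaledDiff P r fs g z.1| ∂P| ≤ a * r / 4)
    (hmul : |blockMean (N / n) (fun i => (fs (D i).1 - (D i).2) * scaledDiff P r fs g (D i).1) j -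
      ∫ z, (fs z.1 - z.2) * scaledDiff P r fs g z.1 ∂P| ≤ a ^ 2 * r ^ 2 / 64) :
    blockLossDiff n D fs g j ≤ -(a ^ 2 * r ^ 2 / 32) := by
  have hdecomp := sq_scaleFactor_mul_blockLossDiff (P := P) (r := r) fs g D n j
  have hsq := sq_blockMean_le (Nat.mul_div_le N n) (fun i => |scaledDiff P r fs g (D i).1|) j
  have ht := scaleFactor_pos (P := P) hr fun z => g z.1 - fs z.1
  have ht₁ := scaleFactor_le_one (P := P) hr fun z => g z.1 - fs z.1
  have hmean : a * r / 2 ≤ ∫ z, |scaledDiff P r fs g z.1| ∂P :=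
    calc a * r / 2 = a * (r / 2) := by ring
      _ ≤ a * min (lpNorm (fun z => g z.1 - fs z.1) 2 P) r := by
        gcongr; exact le_min hgr (by linarith)
      _ ≤ _ := H.mul_min_le_integral_abs_scaledDiff hr hg
  have hmul_nonneg := H.integral_mul_scaledDiff_nonneg hr hg
  set t := scaleFactor P r fun z => g z.1 - fs z.1
  set A := blockMean (N / n) (fun i => |scaledDiff P r fs g (D i).1|) j
  set B := blockMean (N / n) (fun i => |scaledDiff P r fs g (D i).1| ^ 2) j
  set C := blockMean (N / n) (fun i => (fs (D i).1 - (D i).2) * scaledDiff P r fs g (D i).1) j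
  have hA : a * r / 4 ≤ A := by linarith [(abs_le.1 habs).1]
  have hB : a ^ 2 * r ^ 2 / 16 ≤ B :=
    calc a ^ 2 * r ^ 2 / 16 = (a * r / 4) ^ 2 := by ring
      _ ≤ A ^ 2 := by gcongr
      _ ≤ B := hsq
  have hC : -(a ^ 2 * r ^ 2 / 64) ≤ C := by linarith [(abs_le.1 hmul).1]
  have hc : 0 ≤ a ^ 2 * r ^ 2 / 32 := by positivity
  have htC : -(a ^ 2 * r ^ 2 / 32) ≤ 2 * t * C := by nlinarith
  refine le_of_mul_le_mul_left (a := t ^ 2) ?_ (by positivity)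
  calc t ^ 2 * blockLossDiff n D fs g j ≤ -(a ^ 2 * r ^ 2 / 32) := by linarith
    _ ≤ t ^ 2 * -(a ^ 2 * r ^ 2 / 32) := by nlinarith [pow_le_one₀ (n := 2) ht.le ht₁]

lemma card_lt_blockLossDiff_le_deviatingBlocks (ha : 0 < a) (hr : 0 < r) (hg : g ∈ F)
    (hgr : r / 2 ≤ lpNorm (fun z => g z.1 - fs z.1) 2 P) :
    #{j : Fin n | -(a ^ 2 * r ^ 2 / 32) < blockLossDiff n D fs g j} ≤
      deviatingBlocks P n (N / n) (fun z => |scaledDiff P r fs g z.1|) (a * r / 4) D +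
      deviatingBlocks P n (N / n) (fun z => (fs z.1 - z.2) * scaledDiff P r fs g z.1)
        (a ^ 2 * r ^ 2 / 64) D := by
  refine (Finset.card_le_card ?_).trans (Finset.card_union_le _ _)
  rw [← Finset.filter_or]
  refine Finset.monotone_filter_right _ fun j _ hj => ?_
  by_contra! hsmall
  exact hj.not_ge (H.blockLossDiff_le ha hr hg hgr hsmall.1 hsmall.2)

end Deviations

variable [IsProbabilityMeasure P] {gs : ℕ → 𝓧 → ℝ} {D D₁ D₂ : Fin N → 𝓧 × ℝ} {f : 𝓧 → ℝ}

lemma distFunctional_le (ha : 0 < a) (ha₁ : a ≤ 1) (hr : 0 < r) (hgs : IsPointwiseDenseSeq F gs)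
    (hD : ∀ k, (deviatingBlocks P (N / ℓ) ℓ (fun z => |scaledDiff P r fs (gs k) z.1|)
      (a * r / 4) D : ℝ) < (N / ℓ : ℕ) / 10)
    (hf : f ∈ F) (hfr : lpNorm (fun z => f z.1 - fs z.1) 2 P < r) :
    distFunctional ℓ D fs f ≤ 3 / 2 * r := by
  obtain ⟨φ, hφ, hφ_norm⟩ := H.exists_tendsto_lpNorm_sub ha hgs hf
  have hev : ∀ᶠ k in atTop, (#{j : Fin (N / ℓ) |
      5 / 4 * r < blockMean ℓ (fun i => |fs (D i).1 - gs (φ k) (D i).1|) j} : ℝ) ≤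
      (N / ℓ : ℕ) / 10 := by
    filter_upwards [hφ_norm.eventually (gt_mem_nhds hfr)] with k hk
    exact le_trans (mod_cast H.card_lt_blockMean_le_deviatingBlocks ha₁ hr (hgs.mem _) hk.le)
      (hD _).le
  have hlim := card_filter_le_of_tendsto (c' := 3 / 2 * r)
    (fun j : Fin (N / ℓ) => tendsto_blockMean ℓ j fun i =>
      ((hφ (D i).1).const_sub (fs (D i).1)).abs) (by linarith) hev
  refine smallestMedian_le _ ?_
  have hcard : (#{j : Fin (N / ℓ) |
      3 / 2 * r < blockMean ℓ (fun i => |fs (D i).1 - f (D i).1|) j} : ℝ) ≤ (N / ℓ : ℕ) / 10 := by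
    refine le_trans (Nat.cast_le.2 (Finset.card_le_card ?_)) hlim
    exact Finset.monotone_filter_right _ fun j _ => le_of_lt
  have hpos := (Nat.cast_nonneg _).trans_lt (hD 0)
  rw [← Nat.cast_lt (α := ℝ)]
  push_cast
  linarith

lemma two_mul_le_distFunctional (ha : 0 < a) (ha₁ : a ≤ 1) (hr : 0 < r)
    (hgs : IsPointwiseDenseSeq F gs)
    (hD : ∀ k, (deviatingBlocks P (N / ℓ) ℓ (fun z => |scaledDiff P r fs (gs k) z.1|)
      (a * r / 4) D : ℝ) < (N / ℓ : ℕ) / 10)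
    (hf : f ∈ F) (hfr : 4 / a * r < lpNorm (fun z => f z.1 - fs z.1) 2 P) :
    2 * r ≤ distFunctional ℓ D fs f := by
  obtain ⟨φ, hφ, hφ_norm⟩ := H.exists_tendsto_lpNorm_sub ha hgs hf
  have hev : ∀ᶠ k in atTop, (#{j : Fin (N / ℓ) |
      -(3 * r) < -blockMean ℓ (fun i => |fs (D i).1 - gs (φ k) (D i).1|) j} : ℝ) ≤
      (N / ℓ : ℕ) / 10 := by
    filter_upwards [hφ_norm.eventually (lt_mem_nhds hfr)] with k hk
    simp only [neg_lt_neg_iff]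
    exact le_trans (mod_cast H.card_blockMean_lt_le_deviatingBlocks ha ha₁ hr (hgs.mem _) hk.le)
      (hD _).le
  have hlim := card_filter_le_of_tendsto (c' := -(2 * r))
    (fun j : Fin (N / ℓ) => (tendsto_blockMean ℓ j fun i =>
      ((hφ (D i).1).const_sub (fs (D i).1)).abs).neg) (by linarith) hev
  simp only [neg_le_neg_iff] at hlim
  have hpos := (Nat.cast_nonneg _).trans_lt (hD 0)
  refine le_smallestMedian _ ?_
  rw [← Nat.cast_lt (α := ℝ)]
  push_cast
  linarith

lemma lt_two_mul_card_blockLossDiff_neg (ha : 0 < a) (hr : 0 < r) (hgs : IsPointwiseDenseSeq F gs)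
    (hD : ∀ k, (deviatingBlocks P n (N / n) (fun z => |scaledDiff P r fs (gs k) z.1|)
      (a * r / 4) D : ℝ) < n / 10)
    (hD' : ∀ k, (deviatingBlocks P n (N / n)
      (fun z => (fs z.1 - z.2) * scaledDiff P r fs (gs k) z.1)
      (a ^ 2 * r ^ 2 / 64) D : ℝ) < n / 10)
    (hf : f ∈ F) (hfr : r ≤ lpNorm (fun z => f z.1 - fs z.1) 2 P) :
    n < 2 * #{j : Fin n | blockLossDiff n D fs f j < 0} := by
  obtain ⟨φ, hφ, hφ_norm⟩ := H.exists_tendsto_lpNorm_sub ha hgs hf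
  have hev : ∀ᶠ k in atTop, (#{j : Fin n |
      -(a ^ 2 * r ^ 2 / 32) < blockLossDiff n D fs (gs (φ k)) j} : ℝ) ≤ n / 10 + n / 10 := by
    filter_upwards [hφ_norm.eventually (lt_mem_nhds ((half_lt_self hr).trans_le hfr))] with k hk
    exact le_trans (mod_cast H.card_lt_blockLossDiff_le_deviatingBlocks ha hr (hgs.mem _) hk.le)
      (add_le_add (hD (φ k)).le (hD' (φ k)).le)
  have hlim := card_filter_le_of_tendsto (c' := 0) (y₀ := fun j : Fin n => blockLossDiff n D fs f j)
    (fun j : Fin n => tendsto_blockMean (N / n) j fun i =>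
      (((hφ (D i).1).sub_const (D i).2).pow 2).const_sub _) (neg_lt_zero.2 (by positivity)) hev
  have hsplit := Finset.card_filter_add_card_filter_not (s := (Finset.univ : Finset (Fin n)))
    fun j => blockLossDiff n D fs f j < 0
  simp only [not_lt, Finset.card_univ, Fintype.card_fin] at hsplit
  have hpos := (Nat.cast_nonneg _).trans_lt (hD 0)
  rify at hsplit ⊢
  linarith

lemma mem_preliminaryRoundEvent (ha : 0 < a) (ha₁ : a ≤ 1) (hr : 0 < r)
    (hgs : IsPointwiseDenseSeq F gs)
    (hD₁ : ∀ k, (deviatingBlocks P (N / ℓ) ℓ (fun z => |scaledDiff P r fs (gs k) z.1|)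
      (a * r / 4) D₁ : ℝ) < (N / ℓ : ℕ) / 10)
    (hD₂ : ∀ k, (deviatingBlocks P n (N / n) (fun z => |scaledDiff P r fs (gs k) z.1|)
      (a * r / 4) D₂ : ℝ) < n / 10)
    (hD₃ : ∀ k, (deviatingBlocks P n (N / n)
      (fun z => (fs z.1 - z.2) * scaledDiff P r fs (gs k) z.1)
      (a ^ 2 * r ^ 2 / 64) D₂ : ℝ) < n / 10) :
    (D₁, D₂) ∈ preliminaryRoundEvent P F fs N ℓ n (a / 2) 2 r := by
  have hfar (f) (hf : f ∈ F) (hmatch : MatchAllowed ℓ 2 r D₁ fs f) :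
      r ≤ lpNorm (fun z => f z.1 - fs z.1) 2 P := by
    by_contra! hlt
    have := hmatch.trans (H.distFunctional_le ha ha₁ hr hgs hD₁ hf hlt)
    linarith
  have hnear (f) (hf : f ∈ F) (hmatch : ¬ MatchAllowed ℓ 2 r D₁ fs f) :
      lpNorm (fun z => f z.1 - fs z.1) 2 P ≤ 4 / a * r :=
    not_lt.1 fun hlt => hmatch (H.two_mul_le_distFunctional ha ha₁ hr hgs hD₁ hf hlt)
  have hwin (f) (hf : f ∈ F) (hmatch : MatchAllowed ℓ 2 r D₁ fs f) :
      Defeats ℓ n 2 r D₁ D₂ fs f :=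
    ⟨hmatch, H.lt_two_mul_card_blockLossDiff_neg ha hr hgs hD₂ hD₃ hf (hfar f hf hmatch)⟩
  refine ⟨hwin, ⟨H.mem, fun f hf hdef => ?_⟩, fun f hf => ?_⟩
  · have hmatch : MatchAllowed ℓ 2 r D₁ fs f := by
      rw [MatchAllowed, distFunctional_comm]
      exact hdef.1
    exact hdef.not_symm (hwin f hf hmatch)
  · have hno : ¬ MatchAllowed ℓ 2 r D₁ fs f := fun hm => hf.2 fs H.mem (hwin f hf.1 hm)
    refine ⟨hno, ?_⟩
    rw [H.eLpNorm_sub hf.1 H.mem]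
    refine ENNReal.ofReal_le_ofReal ((hnear f hf.1 hno).trans_eq ?_)
    field_simp
    norm_num

end TournamentSetup

end Tournament

section Settings

open Filter Topology

section SecondMoments

variable {𝓩 : Type*} [MeasurableSpace 𝓩] {P : Measure 𝓩} {ξ w : 𝓩 → ℝ}

lemma integral_add_const_mul_sq (hξ : MemLp ξ 2 P) (hw : MemLp w 2 P) (t : ℝ) :
    ∫ z, (ξ z + t * w z) ^ 2 ∂P =
      ∫ z, ξ z ^ 2 ∂P + (2 * t * ∫ z, ξ z * w z ∂P + t ^ 2 * ∫ z, w z ^ 2 ∂P) := by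
  have hξw : Integrable (fun z => 2 * t * (ξ z * w z)) P := (hξ.integrable_mul hw).const_mul _
  have hww : Integrable (fun z => t ^ 2 * w z ^ 2) P := hw.integrable_sq.const_mul _
  have hsum : Integrable (fun z => 2 * t * (ξ z * w z) + t ^ 2 * w z ^ 2) P := hξw.add hww
  rw [← integral_const_mul, ← integral_const_mul, ← integral_add hξw hww,
    ← integral_add hξ.integrable_sq hsum]
  congr 1
  ext z
  ring

lemma lpNorm_congr_ae (h : ξ =ᵐ[P] w) (p : ℝ≥0∞) : lpNorm ξ p P = lpNorm w p P := by
  rw [lpNorm, lpNorm, eLpNorm_congr_ae h]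
  congr 1
  exact propext (aestronglyMeasurable_congr h)

lemma memLp_two_mul_of_indepFun (hξ : MemLp ξ 2 P) (hw : MemLp w 2 P) (h : IndepFun ξ w P) :
    MemLp (fun z => ξ z * w z) 2 P := by
  refine (memLp_two_iff_integrable_sq (hξ.aestronglyMeasurable.mul hw.aestronglyMeasurable)).2 ?_
  simp only [Pi.mul_apply, mul_pow]
  exact (h.comp (measurable_id.pow_const 2) (measurable_id.pow_const 2)).integrable_mul
    hξ.integrable_sq hw.integrable_sq

lemma lpNorm_two_mul_of_indepFun (hξ : MemLp ξ 2 P) (hw : MemLp w 2 P) (h : IndepFun ξ w P) :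
    lpNorm (fun z => ξ z * w z) 2 P = lpNorm ξ 2 P * lpNorm w 2 P := by
  rw [← sq_eq_sq₀ lpNorm_nonneg (mul_nonneg lpNorm_nonneg lpNorm_nonneg), mul_pow,
    lpNorm_two_sq (memLp_two_mul_of_indepFun hξ hw h), lpNorm_two_sq hξ, lpNorm_two_sq hw]
  simp only [mul_pow]
  exact (h.comp (measurable_id.pow_const 2)
    (measurable_id.pow_const 2)).integral_fun_mul_eq_mul_integral
    hξ.integrable_sq.aestronglyMeasurable hw.integrable_sq.aestronglyMeasurable

lemma eLpNorm_two_mul_le_eLpNorm_four_mul (hξ : AEStronglyMeasurable ξ P)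
    (hw : AEStronglyMeasurable w P) :
    eLpNorm (fun z => ξ z * w z) 2 P ≤ eLpNorm ξ 4 P * eLpNorm w 4 P := by
  have : ENNReal.HolderTriple 4 4 2 := ⟨by
    rw [← two_mul, ← div_eq_mul_inv]
    exact (ENNReal.toReal_eq_toReal_iff' (by finiteness) (by finiteness)).1 (by norm_num)⟩
  exact (eLpNorm_smul_le_mul_eLpNorm (p := 4) (q := 4) (r := 2) hw hξ :)

end SecondMoments

variable {𝓧 : Type u} [MeasurableSpace 𝓧] {P : Measure (𝓧 × ℝ)} {F : Set (𝓧 → ℝ)}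
  {fs f h : 𝓧 → ℝ} {q L σ : ℝ}

namespace LearningProblem

variable (H : LearningProblem P F fs)
include H

lemma memLp_noise (hf : f ∈ F) : MemLp (fun z : 𝓧 × ℝ => f z.1 - z.2) 2 P :=
  ((H.memLp f hf).comp_measurePreserving (measurable_fst.measurePreserving P)).sub H.memLp_target

lemma memLp_sub (hf : f ∈ F) (hh : h ∈ F) : MemLp (fun z : 𝓧 × ℝ => f z.1 - h z.1) 2 P :=
  memLp_sub_comp_fst (H.memLp f hf) (H.memLp h hh)

lemma eLpNorm_sub (hf : f ∈ F) (hh : h ∈ F) (p : ℝ≥0∞) :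
    eLpNorm (fun z : 𝓧 × ℝ => f z.1 - h z.1) p P = eLpNorm (f - h) p (P.map Prod.fst) :=
  eLpNorm_sub_comp_fst (H.memLp f hf).aestronglyMeasurable (H.memLp h hh).aestronglyMeasurable p

lemma l1Ratio_mul_lpNorm_sub_le [IsProbabilityMeasure P] (hq : 2 < q) (hL : 1 ≤ L) (hf : f ∈ F)
    (hh : h ∈ F) (hfh : eLpNorm (f - h) (ENNReal.ofReal q) (P.map Prod.fst) ≤
      ENNReal.ofReal L * eLpNorm (f - h) 2 (P.map Prod.fst)) :
    l1Ratio q L * lpNorm (fun z => f z.1 - h z.1) 2 P ≤ ∫ z, |f z.1 - h z.1| ∂P :=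
  have hw := H.memLp_sub hf hh
  l1Ratio_mul_lpNorm_le hw (hw.mono_exponent one_le_two) hq hL <| by
    rwa [H.eLpNorm_sub hf hh, H.eLpNorm_sub hf hh]

lemma integral_mul_nonneg_of_convex (hF : Convex ℝ F) (hf : f ∈ F) :
    0 ≤ ∫ z, (fs z.1 - z.2) * (f z.1 - fs z.1) ∂P := by
  have hfs := H.minimizer.1
  set B := ∫ z, (fs z.1 - z.2) * (f z.1 - fs z.1) ∂P
  set C := ∫ z, (f z.1 - fs z.1) ^ 2 ∂P
  have hvar (t : ℝ) (ht : t ∈ Set.Ioo 0 1) : 0 ≤ 2 * B + t * C := by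
    have hmin := H.minimizer.2 _ (hF hfs hf (sub_nonneg.2 ht.2.le) ht.1.le (sub_add_cancel 1 t))
    have hrisk : ∫ z, (((1 - t) • fs + t • f) z.1 - z.2) ^ 2 ∂P =
        ∫ z, (fs z.1 - z.2) ^ 2 ∂P + (2 * t * B + t ^ 2 * C) := by
      rw [← integral_add_const_mul_sq (H.memLp_noise hfs) (H.memLp_sub hf hfs)]
      congr 1
      ext z
      simp only [Pi.add_apply, Pi.smul_apply, smul_eq_mul]
      ring
    have hmul : 0 ≤ t * (2 * B + t * C) := by linarith
    exact nonneg_of_mul_nonneg_right hmul ht.1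
  have hlim : Tendsto (fun t => 2 * B + t * C) (𝓝[>] 0) (𝓝 (2 * B + 0 * C)) :=
    (Continuous.tendsto (by fun_prop) 0).mono_left nhdsWithin_le_nhds
  have := ge_of_tendsto hlim (eventually_of_mem (Ioo_mem_nhdsGT one_pos) hvar)
  linarith

section IndependentNoise

variable {f₀ : 𝓧 → ℝ} (hind : IndepFun (fun z : 𝓧 × ℝ => z.2 - f₀ z.1) Prod.fst P)
include hind

lemma indepFun_sub (hf : f ∈ F) (hh : h ∈ F) :
    IndepFun (fun z : 𝓧 × ℝ => f₀ z.1 - z.2) (fun z => f z.1 - h z.1) P := by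
  simpa only [Function.comp_def, Pi.sub_apply, neg_sub] using
    hind.comp measurable_neg ((H.measurable f hf).sub (H.measurable h hh))

lemma integral_noise_mul_eq_zero (hf₀ : f₀ ∈ F) (hmean : ∫ z, (z.2 - f₀ z.1) ∂P = 0)
    (hf : f ∈ F) (hh : h ∈ F) : ∫ z, (f₀ z.1 - z.2) * (f z.1 - h z.1) ∂P = 0 := by
  have hmean' : ∫ z, (f₀ z.1 - z.2) ∂P = 0 := by
    simpa only [← integral_neg, neg_sub, neg_zero] using congr_arg Neg.neg hmean
  rw [(H.indepFun_sub hind hf hh).integral_fun_mul_eq_mul_integral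
    (H.memLp_noise hf₀).aestronglyMeasurable (H.memLp_sub hf hh).aestronglyMeasurable, hmean',
    zero_mul]

lemma minimizer_ae_eq_of_indepFun (hf₀ : f₀ ∈ F) (hmean : ∫ z, (z.2 - f₀ z.1) ∂P = 0) :
    (fun z : 𝓧 × ℝ => fs z.1) =ᵐ[P] fun z => f₀ z.1 := by
  have hfs := H.minimizer.1
  have hw := H.memLp_sub hfs hf₀
  have hexpand := integral_add_const_mul_sq (H.memLp_noise hf₀) hw 1
  rw [H.integral_noise_mul_eq_zero hind hf₀ hmean hfs hf₀] at hexpand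
  simp only [one_mul, sub_add_sub_cancel', mul_zero, zero_add, one_pow] at hexpand
  have hzero : ∫ z, (fs z.1 - f₀ z.1) ^ 2 ∂P = 0 :=
    le_antisymm (by linarith [H.minimizer.2 f₀ hf₀]) (integral_nonneg fun _ => sq_nonneg _)
  rw [integral_eq_zero_iff_of_nonneg (fun _ => sq_nonneg _) hw.integrable_sq] at hzero
  filter_upwards [hzero] with z hz
  exact sub_eq_zero.1 (pow_eq_zero_iff two_ne_zero |>.1 hz)

end IndependentNoise

end LearningProblem

namespace ConvexSetting

variable (H : ConvexSetting L σ P F fs)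
include H

lemma eLpNorm_mul_le (hL : 0 ≤ L) (hσ : 0 ≤ σ) (hf : f ∈ F) :
    eLpNorm (fun z => (fs z.1 - z.2) * (f z.1 - fs z.1)) 2 P ≤
      ENNReal.ofReal (L ^ 2 * σ * lpNorm (fun z => f z.1 - fs z.1) 2 P) := by
  have hfs := H.minimizer.1
  have hw := H.memLp_sub hf hfs
  calc eLpNorm (fun z => (fs z.1 - z.2) * (f z.1 - fs z.1)) 2 P
      ≤ eLpNorm (fun z : 𝓧 × ℝ => fs z.1 - z.2) 4 P *
          eLpNorm (fun z : 𝓧 × ℝ => f z.1 - fs z.1) 4 P :=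
        eLpNorm_two_mul_le_eLpNorm_four_mul (H.memLp_noise hfs).aestronglyMeasurable
          hw.aestronglyMeasurable
    _ ≤ ENNReal.ofReal L * ENNReal.ofReal σ *
          (ENNReal.ofReal L * eLpNorm (fun z : 𝓧 × ℝ => f z.1 - fs z.1) 2 P) := by
        gcongr
        · exact (H.norm_noise fs hfs).trans (mul_le_mul_right H.noise_le _)
        · simpa only [H.eLpNorm_sub hf hfs] using H.norm_sub f hf fs hfs
    _ = ENNReal.ofReal (L ^ 2 * σ * lpNorm (fun z => f z.1 - fs z.1) 2 P) := by
        rw [← ofReal_lpNorm hw, ← ENNReal.ofReal_mul hL, ← ENNReal.ofReal_mul hL,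
          ← ENNReal.ofReal_mul (by positivity)]
        ring_nf

lemma tournamentSetup [IsProbabilityMeasure P] (hL : 1 ≤ L) (hσ : 0 ≤ σ) :
    TournamentSetup (l1Ratio 4 L) (L ^ 2) σ P F fs := by
  have hfs := H.minimizer.1
  have hbound (f) (hf : f ∈ F) := H.eLpNorm_mul_le (by linarith) hσ hf
  have hmem (f) (hf : f ∈ F) : MemLp (fun z : 𝓧 × ℝ => (fs z.1 - z.2) * (f z.1 - fs z.1)) 2 P :=
    ⟨(H.memLp_noise hfs).aestronglyMeasurable.mul (H.memLp_sub hf hfs).aestronglyMeasurable,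
      (hbound f hf).trans_lt ENNReal.ofReal_lt_top⟩
  exact
    { measurable := H.measurable
      pointwiseMeasurable := H.pointwiseMeasurable
      memLp := H.memLp
      mem := hfs
      mul_lpNorm_le_integral_abs := fun f hf h hh =>
        H.l1Ratio_mul_lpNorm_sub_le (by norm_num) hL hf hh <| by
          simpa only [ENNReal.ofReal_ofNat] using H.norm_sub f hf h hh
      memLp_mul := hmem
      lpNorm_mul_le := fun f hf => by
        have := hbound f hf
        rwa [← ofReal_lpNorm (hmem f hf), ENNReal.ofReal_le_ofReal_iff
          (mul_nonneg (by positivity) lpNorm_nonneg)] at this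
      integral_mul_nonneg := fun f hf => H.integral_mul_nonneg_of_convex H.convex hf }

end ConvexSetting

lemma IndependentNoiseSetting.tournamentSetup [IsProbabilityMeasure P]
    (H : IndependentNoiseSetting q L σ P F fs) (hq : 2 < q) (hL : 1 ≤ L) (hσ : 0 ≤ σ) :
    TournamentSetup (l1Ratio q L) 1 σ P F fs := by
  have hfs := H.minimizer.1
  obtain ⟨f₀, hf₀, hind, hmean, hnoise⟩ := H.noise
  have hξ := H.memLp_noise hf₀
  have hξσ : lpNorm (fun z : 𝓧 × ℝ => f₀ z.1 - z.2) 2 P ≤ σ := by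
    rw [← ENNReal.ofReal_le_ofReal_iff hσ, ofReal_lpNorm hξ]
    exact (eLpNorm_sub_comm _ _ 2 P).trans_le hnoise
  have hmul (f : 𝓧 → ℝ) : (fun z : 𝓧 × ℝ => (fs z.1 - z.2) * (f z.1 - fs z.1)) =ᵐ[P]
      fun z => (f₀ z.1 - z.2) * (f z.1 - fs z.1) := by
    filter_upwards [H.minimizer_ae_eq_of_indepFun hind hf₀ hmean] with z hz
    rw [hz]
  have hindep (f) (hf : f ∈ F) := H.indepFun_sub hind hf hfs
  exact
    { measurable := H.measurable
      pointwiseMeasurable := H.pointwiseMeasurable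
      memLp := H.memLp
      mem := hfs
      mul_lpNorm_le_integral_abs := fun f hf h hh =>
        H.l1Ratio_mul_lpNorm_sub_le hq hL hf hh <| H.norm_span _ <|
          Submodule.sub_mem _ (Submodule.subset_span hf) (Submodule.subset_span hh)
      memLp_mul := fun f hf => (memLp_congr_ae (hmul f)).2 <|
        memLp_two_mul_of_indepFun hξ (H.memLp_sub hf hfs) (hindep f hf)
      lpNorm_mul_le := fun f hf => by
        rw [lpNorm_congr_ae (hmul f),
          lpNorm_two_mul_of_indepFun hξ (H.memLp_sub hf hfs) (hindep f hf), one_mul]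
        exact mul_le_mul_of_nonneg_right hξσ lpNorm_nonneg
      integral_mul_nonneg := fun f hf => by
        rw [integral_congr_ae (hmul f), H.integral_noise_mul_eq_zero hind hf₀ hmean hf hfs] }

end Settings

section Constants

variable {𝓧 : Type u} [MeasurableSpace 𝓧] {P : Measure (𝓧 × ℝ)} {F : Set (𝓧 → ℝ)}
  {fs : 𝓧 → ℝ} {a S σ r c₁ : ℝ} {N ℓ n m : ℕ}

lemma lt_ofReal_of_two_mul_le {x : ℝ≥0∞} (hr : 0 < r) (h : 2 * x ≤ ENNReal.ofReal r) :
    x < ENNReal.ofReal r := by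
  rcases eq_or_ne x 0 with rfl | hx₀
  · exact ENNReal.ofReal_pos.2 hr
  have hx : x ≠ ⊤ := by
    rintro rfl
    simp at h
  rw [two_mul] at h
  exact (ENNReal.lt_add_right hx hx₀).trans_le h

lemma holdsWithProb_of_nonpos {Ω : Type u} [MeasurableSpace Ω] (Q : Measure Ω) {p : ℝ}
    (hp : p ≤ 0) (E : Set Ω) : HoldsWithProb Q p E :=
  ⟨∅, Set.empty_subset _, MeasurableSet.empty, by simp [ENNReal.ofReal_of_nonpos hp]⟩

lemma holdsWithProb_prod {Ω Ω' : Type u} [MeasurableSpace Ω] [MeasurableSpace Ω'] {Q : Measure Ω}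
    {Q' : Measure Ω'} [IsProbabilityMeasure Q] [IsProbabilityMeasure Q'] {B : Set Ω} {B' : Set Ω'}
    (hB : MeasurableSet B) (hB' : MeasurableSet B') {p p' : ℝ} (hp : 0 ≤ p) (hp' : 0 ≤ p')
    (hQ : Q B ≤ ENNReal.ofReal p) (hQ' : Q' B' ≤ ENNReal.ofReal p') {E : Set (Ω × Ω')}
    (hE : ∀ x ∉ B, ∀ y ∉ B', (x, y) ∈ E) : HoldsWithProb (Q.prod Q') (1 - (p + p')) E := by
  refine ⟨Bᶜ ×ˢ B'ᶜ, fun x hx => hE x.1 hx.1 x.2 hx.2, hB.compl.prod hB'.compl, ?_⟩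
  have hbad : Q.prod Q' (Bᶜ ×ˢ B'ᶜ)ᶜ ≤ ENNReal.ofReal (p + p') := by
    rw [Set.compl_prod_eq_union, compl_compl, compl_compl, ENNReal.ofReal_add hp hp']
    refine (measure_union_le _ _).trans ?_
    simpa only [Measure.prod_prod, measure_univ, mul_one, one_mul] using add_le_add hQ hQ'
  rw [ENNReal.ofReal_sub _ (add_nonneg hp hp'), ENNReal.ofReal_one,
    ← compl_compl (Bᶜ ×ˢ B'ᶜ), prob_compl_eq_one_sub (hB.compl.prod hB'.compl).compl]
  exact tsub_le_tsub_left hbad 1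

lemma HoldsWithProb.mono {Ω : Type u} [MeasurableSpace Ω] {Q : Measure Ω} {p p' : ℝ} {E : Set Ω}
    (h : HoldsWithProb Q p E) (hp : p' ≤ p) : HoldsWithProb Q p' E :=
  let ⟨A, hAE, hA, hpA⟩ := h
  ⟨A, hAE, hA, (ENNReal.ofReal_le_ofReal hp).trans hpA⟩

lemma le_two_mul_div_mul (hm : 0 < m) (hmN : m ≤ N) : N ≤ 2 * (N / m * m) := by
  have hdiv := Nat.div_add_mod' N m
  have hmod := Nat.mod_lt N hm
  have hle := Nat.le_mul_of_pos_left m (Nat.div_pos hmN hm)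
  lia

lemma TournamentSetup.holdsWithProb [IsProbabilityMeasure P] (H : TournamentSetup a S σ P F fs)
    (hℓ : 0 < ℓ) (hℓN : ℓ ≤ N) (hn : 0 < n) (hnN : n ≤ N) (ha : 0 < a) (ha₁ : a ≤ 1) (hr : 0 < r)
    (hS : 0 ≤ S) (hσ : 0 ≤ σ) (hc₁ : 0 ≤ c₁) (hrE : rE P N F fs c₁ < ENNReal.ofReal r)
    (hrM : rM P N F fs c₁ < ENNReal.ofReal r) (h₁ : r / √ℓ + 8 * c₁ * r ≤ a * r / 4 / 20)
    (h₂ : r / √(N / n : ℕ) + 8 * c₁ * r ≤ a * r / 4 / 20)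
    (h₃ : S * σ * r / √(N / n : ℕ) + 8 * c₁ * r ^ 2 ≤ a ^ 2 * r ^ 2 / 64 / 20) :
    HoldsWithProb (sampleLaw P N)
      (1 - (Real.exp (-((N / ℓ : ℕ) / 200)) + (Real.exp (-(n / 200)) + Real.exp (-(n / 200)))))
      (preliminaryRoundEvent P F fs N ℓ n (a / 2) 2 r) := by
  obtain ⟨gs, hgs⟩ := H.pointwiseMeasurable.exists_isPointwiseDenseSeq ⟨fs, H.mem⟩
  have hkN : N / ℓ * ℓ ≤ N := Nat.div_mul_le_self N ℓ
  have hkN' : N ≤ 2 * (N / ℓ * ℓ) := le_two_mul_div_mul hℓ hℓN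
  have hnm : n * (N / n) ≤ N := Nat.mul_div_le N n
  have hnm' : N ≤ 2 * (n * (N / n)) := mul_comm n (N / n) ▸ le_two_mul_div_mul hn hnN
  have hm : 0 < N / n := Nat.div_pos hnN hn
  have habs (k) := (H.measurable_scaledDiff (r := r) (hgs.mem k)).abs
  have hmul (k) := H.measurable_mul_scaledDiff (r := r) (hgs.mem k)
  have hp₁ := H.measure_exists_deviatingBlocks_abs_le hkN hkN' hℓ hr hc₁ (by positivity) hrE
    hgs.mem h₁
  have hp₂ := H.measure_exists_deviatingBlocks_abs_le hnm hnm' hm hr hc₁ (by positivity) hrE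
    hgs.mem h₂
  have hp₃ := H.measure_exists_deviatingBlocks_mul_le hnm hnm' hm hr hc₁ (by positivity) hS hσ hrM
    hgs.mem h₃
  have hp₂₃ := (measure_union_le _ _).trans (add_le_add hp₂ hp₃)
  rw [← ENNReal.ofReal_add (Real.exp_nonneg _) (Real.exp_nonneg _)] at hp₂₃
  refine holdsWithProb_prod (measurableSet_exists_le_deviatingBlocks hkN hℓ habs _ _)
    ((measurableSet_exists_le_deviatingBlocks hnm hm habs _ _).union
      (measurableSet_exists_le_deviatingBlocks hnm hm hmul _ _))
    (Real.exp_nonneg _) (by positivity) hp₁ hp₂₃ fun D₁ hD₁ D₂ hD₂ => ?_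
  simp only [Set.mem_union, Set.mem_ofPred_eq, not_or, not_exists, not_le] at hD₁ hD₂
  exact H.mem_preliminaryRoundEvent ha ha₁ hr hgs hD₁ hD₂.1 hD₂.2

lemma div_sqrt_le_of_sq_le {x y m : ℝ} (hy : 0 < y) (hm : (x / y) ^ 2 ≤ m) : x / √m ≤ y := by
  have hsqrt : x / y ≤ √m := Real.le_sqrt_of_sq_le hm
  rcases (Real.sqrt_nonneg m).eq_or_lt with h₀ | hpos
  · rw [← h₀, div_zero]
    exact hy.le
  · rwa [div_le_comm₀ hpos hy]

lemma one_div_two_mul_le_natCast_div {t : ℝ} (hn : 0 < n) (hnN : n ≤ N) (ht : 0 < t)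
    (h : (n : ℝ) ≤ t * N) : 1 / (2 * t) ≤ (N / n : ℕ) := by
  have hN : (0 : ℝ) < N := mod_cast hn.trans_le hnN
  have hblocks : (N : ℝ) ≤ 2 * ((N / n : ℕ) * n) := mod_cast le_two_mul_div_mul hn hnN
  rw [div_le_iff₀ (by positivity)]
  refine le_of_mul_le_mul_right (a := (N : ℝ)) ?_ hN
  calc 1 * (N : ℝ) ≤ 2 * ((N / n : ℕ) * n) := by rwa [one_mul]
    _ ≤ 2 * ((N / n : ℕ) * (t * N)) := by gcongr
    _ = (N / n : ℕ) * (2 * t) * N := by ring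

lemma exp_add_exp_add_exp_le {k n y : ℝ} (hy : 2 * Real.exp (-y) ≤ 1) (hk : 800 * y ≤ k + 1)
    (hn : 800 * y ≤ n + 1) :
    Real.exp (-(k / 200)) + (Real.exp (-(n / 200)) + Real.exp (-(n / 200))) ≤
      2 * Real.exp (-y) := by
  have hy' := Real.add_one_le_exp (-y)
  have hexp {x : ℝ} (hx : 800 * y ≤ x + 1) :
      Real.exp (-(x / 200)) ≤ Real.exp (-y) * Real.exp (-y) := by
    rw [← Real.exp_add, Real.exp_le_exp]
    linarith
  have hsq := mul_le_mul_of_nonneg_left hy (Real.exp_nonneg (-y))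
  linarith [hexp hk, hexp hn, Real.exp_pos (-y)]

/-- The length `ℓ` of the blocks of the distance oracle. -/
noncomputable def oracleBlockLength (a : ℝ) : ℕ := ⌈(160 / a) ^ 2⌉₊

/-- The constant `θ` in the number of blocks of the second sample. It is chosen so that these blocks
have length at least `(2560 S / a²)² max {1, (σ/r)²}`. -/
noncomputable def blockDensity (a S : ℝ) : ℝ := (a ^ 2 / (2560 * S)) ^ 2 / 2

/-- The constant `c₀` in the exponent of the probability estimate. -/
noncomputable def deviationRate (a S : ℝ) : ℝ :=
  min (blockDensity a S / 800) (1 / (800 * oracleBlockLength a))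

lemma oracleBlockLength_pos (ha : 0 < a) : 0 < oracleBlockLength a :=
  Nat.ceil_pos.2 (by positivity)

lemma blockDensity_pos (ha : 0 < a) (hS : 0 < S) : 0 < blockDensity a S := by
  unfold blockDensity
  positivity

lemma deviationRate_pos (ha : 0 < a) (hS : 0 < S) : 0 < deviationRate a S := by
  have := blockDensity_pos ha hS
  have := oracleBlockLength_pos ha
  unfold deviationRate
  positivity

lemma sq_div_le (ha : 0 < a) (ha₁ : a ≤ 1) (hS : 1 ≤ S) : a ^ 2 / (2560 * S) ≤ a / 160 := by
  rw [div_le_div_iff₀ (by positivity) (by norm_num)]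
  nlinarith

lemma blockDensity_lt (ha : 0 < a) (ha₁ : a ≤ 1) (hS : 1 ≤ S) : blockDensity a S < 1 / 4 := by
  have hle := pow_le_pow_left₀ (by positivity) (sq_div_le ha ha₁ hS) 2
  unfold blockDensity
  nlinarith

lemma numBlocks_le {θ : ℝ} (hθ : 0 ≤ θ) (σ r : ℝ) (N : ℕ) :
    (numBlocks θ σ r N : ℝ) ≤ θ * min 1 (r ^ 2 / σ ^ 2) * N := by
  rw [numBlocks, div_pow, mul_right_comm]
  exact Nat.floor_le (by positivity)

lemma div_sqrt_add_le (ha : 0 < a) (ha₁ : a ≤ 1) (hr : 0 < r) {m : ℝ} (hm : (160 / a) ^ 2 ≤ m) :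
    r / √m + 8 * (a ^ 2 / 20480) * r ≤ a * r / 4 / 20 := by
  have hsqrt : r / √m ≤ a * r / 160 :=
    div_sqrt_le_of_sq_le (by positivity) (le_trans (by field_simp; rfl) hm)
  have hsq : a ^ 2 * r ≤ a * r := mul_le_mul_of_nonneg_right (by nlinarith) hr.le
  have hpos : 0 < a * r := by positivity
  linarith

lemma mul_div_sqrt_add_le (ha : 0 < a) (hr : 0 < r) {m : ℝ}
    (hm : (2560 * S * σ / (a ^ 2 * r)) ^ 2 ≤ m) :
    S * σ * r / √m + 8 * (a ^ 2 / 20480) * r ^ 2 ≤ a ^ 2 * r ^ 2 / 64 / 20 := by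
  have hsqrt : S * σ * r / √m ≤ a ^ 2 * r ^ 2 / 2560 :=
    div_sqrt_le_of_sq_le (by positivity) (le_trans (by field_simp; rfl) hm)
  linarith

lemma mul_deviationRate_le_numBlocks (a S σ r : ℝ) (N : ℕ) :
    800 * (deviationRate a S * N * min 1 (r ^ 2 / σ ^ 2)) ≤
      numBlocks (blockDensity a S) σ r N + 1 :=
  calc 800 * (deviationRate a S * N * min 1 (r ^ 2 / σ ^ 2))
      ≤ 800 * (blockDensity a S / 800 * N * min 1 (r ^ 2 / σ ^ 2)) := by
        gcongr
        exact min_le_left _ _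
    _ = blockDensity a S * N * min 1 ((r / σ) ^ 2) := by rw [div_pow]; ring
    _ ≤ numBlocks (blockDensity a S) σ r N + 1 := (Nat.lt_floor_add_one _).le

lemma mul_deviationRate_le_oracleBlocks (a S σ r : ℝ) (N : ℕ) :
    800 * (deviationRate a S * N * min 1 (r ^ 2 / σ ^ 2)) ≤ (N / oracleBlockLength a : ℕ) + 1 :=
  calc 800 * (deviationRate a S * N * min 1 (r ^ 2 / σ ^ 2))
      ≤ 800 * (1 / (800 * oracleBlockLength a) * N * 1) := by
        gcongr
        · exact min_le_right _ _
        · exact min_le_left _ _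
    _ = (N : ℝ) / oracleBlockLength a := by ring
    _ ≤ (N / oracleBlockLength a : ℕ) + 1 := by
        rw [← Nat.floor_div_eq_div (K := ℝ)]
        exact (Nat.lt_floor_add_one _).le

lemma sq_le_natCast_div_numBlocks (ha : 0 < a) (hS : 0 < S) (hσ : 0 < σ) (hr : 0 < r)
    (hn : 0 < numBlocks (blockDensity a S) σ r N) (hnN : numBlocks (blockDensity a S) σ r N ≤ N) :
    (2560 * S / a ^ 2) ^ 2 ≤ (N / numBlocks (blockDensity a S) σ r N : ℕ) ∧
      (2560 * S * σ / (a ^ 2 * r)) ^ 2 ≤ (N / numBlocks (blockDensity a S) σ r N : ℕ) := by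
  have hθ := blockDensity_pos ha hS
  have hle {t : ℝ} (ht : 0 < t) (hmin : min 1 (r ^ 2 / σ ^ 2) ≤ t) :=
    one_div_two_mul_le_natCast_div hn hnN (mul_pos hθ ht)
      ((numBlocks_le hθ.le σ r N).trans (by gcongr))
  refine ⟨le_of_eq_of_le ?_ (hle one_pos (min_le_left _ _)),
    le_of_eq_of_le ?_ (hle (by positivity) (min_le_right _ _))⟩ <;>
  · unfold blockDensity
    field_simp

lemma TournamentSetup.holdsWithProb_of_deviationRate [IsProbabilityMeasure P]
    (H : TournamentSetup a S σ P F fs) (ha : 0 < a) (ha₁ : a ≤ 1) (hS : 1 ≤ S) (hσ : 0 < σ)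
    (hr : 0 < r) (hrE : rE P N F fs (a ^ 2 / 20480) < ENNReal.ofReal r)
    (hrM : rM P N F fs (a ^ 2 / 20480) < ENNReal.ofReal r)
    (hN : 2 * Real.exp (-(deviationRate a S * N * min 1 (r ^ 2 / σ ^ 2))) ≤ 1) :
    HoldsWithProb (sampleLaw P N)
      (1 - 2 * Real.exp (-(deviationRate a S * N * min 1 (r ^ 2 / σ ^ 2))))
      (preliminaryRoundEvent P F fs N (oracleBlockLength a)
        (numBlocks (blockDensity a S) σ r N) (a / 2) 2 r) := by
  have hθ := blockDensity_pos ha (one_pos.trans_le hS)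
  have hhalf := Real.add_one_le_exp (-(deviationRate a S * N * min 1 (r ^ 2 / σ ^ 2)))
  have hn := mul_deviationRate_le_numBlocks a S σ r N
  have hk := mul_deviationRate_le_oracleBlocks a S σ r N
  have hn₀ : 0 < numBlocks (blockDensity a S) σ r N := Nat.cast_pos (α := ℝ).1 (by linarith)
  have hk₀ : 0 < N / oracleBlockLength a := Nat.cast_pos (α := ℝ).1 (by linarith)
  have hnN : numBlocks (blockDensity a S) σ r N ≤ N := by
    rify
    refine (numBlocks_le hθ.le σ r N).trans (mul_le_of_le_one_left N.cast_nonneg ?_)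
    exact mul_le_one₀ (by linarith [blockDensity_lt ha ha₁ hS]) (by positivity) (min_le_left _ _)
  have hlen := sq_le_natCast_div_numBlocks ha (by linarith) hσ hr hn₀ hnN
  have hratio : 160 / a ≤ 2560 * S / a ^ 2 := by
    simpa only [inv_div] using inv_anti₀ (by positivity) (sq_div_le ha ha₁ hS)
  have hprob := H.holdsWithProb (oracleBlockLength_pos ha) (Nat.div_pos_iff.1 hk₀).2 hn₀ hnN
    ha ha₁ hr (by linarith) hσ.le (by positivity) hrE hrM
    (div_sqrt_add_le ha ha₁ hr (Nat.le_ceil _))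
    (div_sqrt_add_le ha ha₁ hr ((pow_le_pow_left₀ (by positivity) hratio 2).trans hlen.1))
    (mul_div_sqrt_add_le ha hr hlen.2)
  exact hprob.mono (sub_le_sub_left (exp_add_exp_add_exp_le hN hk hn) 1)

end Constants

end MoMTournament

open MoMTournament in
theorem proposition3p4_general {a S : ℝ} (ha : 0 < a) (ha₁ : a ≤ 1) (hS : 1 ≤ S) :
    ∃ (c₀ c₁ θ α β : ℝ) (ℓ : ℕ),
      0 < c₀ ∧ 0 < c₁ ∧ 0 < θ ∧ θ < 1 / 4 ∧ 0 < α ∧ α < 1 ∧ 1 < β ∧ 1 ≤ ℓ ∧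
      ∀ (𝓧 : Type u) [MeasurableSpace 𝓧] (P : Measure (𝓧 × ℝ)) [IsProbabilityMeasure P]
        (F : Set (𝓧 → ℝ)) (fs : 𝓧 → ℝ) (N : ℕ) (σ r : ℝ), 0 < σ → 0 < r →
        TournamentSetup a S σ P F fs →
        2 * max (rE P N F fs c₁) (rM P N F fs c₁) ≤ ENNReal.ofReal r →
        HoldsWithProb (sampleLaw P N) (1 - 2 * Real.exp (-(c₀ * N * min 1 (r ^ 2 / σ ^ 2))))
          (preliminaryRoundEvent P F fs N ℓ (numBlocks θ σ r N) α β r) := by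
  have hS₀ : 0 < S := by linarith
  refine ⟨deviationRate a S, a ^ 2 / 20480, blockDensity a S, a / 2, 2, oracleBlockLength a,
    deviationRate_pos ha hS₀, by positivity, blockDensity_pos ha hS₀, blockDensity_lt ha ha₁ hS,
    by positivity, by linarith, one_lt_two, oracleBlockLength_pos ha, ?_⟩
  intro 𝓧 _ P _ F fs N σ r hσ hr H hmax
  obtain ⟨hrE, hrM⟩ := max_lt_iff.1 (lt_ofReal_of_two_mul_le hr hmax)
  rcases le_total (2 * Real.exp (-(deviationRate a S * N * min 1 (r ^ 2 / σ ^ 2)))) 1 with hN | hN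
  · exact H.holdsWithProb_of_deviationRate ha ha₁ hS hσ hr hrE hrM hN
  · exact holdsWithProb_of_nonpos _ (sub_nonpos.2 hN) _

theorem proposition3p4 :
    (∀ L : ℝ, 1 ≤ L →
      ∃ (c₀ c₁ c₂ θ α β : ℝ) (ℓ : ℕ),
        0 < c₀ ∧ 0 < c₁ ∧ 0 < c₂ ∧ c₂ < 1 ∧ 0 < θ ∧ θ < 1 / 4 ∧ 0 < α ∧ α < 1 ∧ 1 < β ∧ 1 ≤ ℓ ∧
        ∀ (𝓧 : Type u) [MeasurableSpace 𝓧] (P : Measure (𝓧 × ℝ)) [IsProbabilityMeasure P]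
          (F : Set (𝓧 → ℝ)) (fs : 𝓧 → ℝ) (N : ℕ) (σ r : ℝ), 0 < σ → 0 < r →
          MoMTournament.ConvexSetting L σ P F fs →
          2 * MoMTournament.rStar P N F fs σ c₁ c₂ ≤ ENNReal.ofReal r →
          MoMTournament.HoldsWithProb (MoMTournament.sampleLaw P N)
            (1 - 2 * Real.exp (-(c₀ * N * min 1 (r ^ 2 / σ ^ 2))))
            (MoMTournament.preliminaryRoundEvent P F fs N ℓ
              (MoMTournament.numBlocks θ σ r N) α β r)) ∧
    (∀ q L : ℝ, 2 < q → 1 < L →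
      ∃ (c₀ c₁ c₂ θ α β : ℝ) (ℓ : ℕ),
        0 < c₀ ∧ 0 < c₁ ∧ 0 < c₂ ∧ c₂ < 1 ∧ 0 < θ ∧ θ < 1 / 4 ∧ 0 < α ∧ α < 1 ∧ 1 < β ∧ 1 ≤ ℓ ∧
        ∀ (𝓧 : Type u) [MeasurableSpace 𝓧] (P : Measure (𝓧 × ℝ)) [IsProbabilityMeasure P]
          (F : Set (𝓧 → ℝ)) (fs : 𝓧 → ℝ) (N : ℕ) (σ r : ℝ), 0 < σ → 0 < r →
          MoMTournament.IndependentNoiseSetting q L σ P F fs →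
          2 * MoMTournament.rStar P N F fs σ c₁ c₂ ≤ ENNReal.ofReal r →
          MoMTournament.HoldsWithProb (MoMTournament.sampleLaw P N)
            (1 - 2 * Real.exp (-(c₀ * N * min 1 (r ^ 2 / σ ^ 2))))
            (MoMTournament.preliminaryRoundEvent P F fs N ℓ
              (MoMTournament.numBlocks θ σ r N) α β r)) := by
  refine ⟨fun L hL => ?_, fun q L hq hL => ?_⟩
  · obtain ⟨c₀, c₁, θ, α, β, ℓ, hc₀, hc₁, hθ, hθ', hα, hα', hβ, hℓ, h⟩ :=
      proposition3p4_general (MoMTournament.l1Ratio_pos (q := 4) hL)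
        (MoMTournament.l1Ratio_le_one (by norm_num) hL) (one_le_pow₀ hL (n := 2))
    exact ⟨c₀, c₁, 1 / 2, θ, α, β, ℓ, hc₀, hc₁, by norm_num, by norm_num, hθ, hθ', hα, hα', hβ, hℓ,
      fun 𝓧 _ P _ F fs N σ r hσ hr H hrS =>
        h 𝓧 P F fs N σ r hσ hr (H.tournamentSetup hL hσ.le)
          ((mul_le_mul_right (le_max_right _ _) 2).trans hrS)⟩
  · obtain ⟨c₀, c₁, θ, α, β, ℓ, hc₀, hc₁, hθ, hθ', hα, hα', hβ, hℓ, h⟩ :=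
      proposition3p4_general (MoMTournament.l1Ratio_pos (q := q) hL.le)
        (MoMTournament.l1Ratio_le_one hq hL.le) le_rfl
    exact ⟨c₀, c₁, 1 / 2, θ, α, β, ℓ, hc₀, hc₁, by norm_num, by norm_num, hθ, hθ', hα, hα', hβ, hℓ,
      fun 𝓧 _ P _ F fs N σ r hσ hr H hrS =>
        h 𝓧 P F fs N σ r hσ hr (H.tournamentSetup hq hL.le hσ.le)
          ((mul_le_mul_right (le_max_right _ _) 2).trans hrS)⟩
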